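/- Let $n\ge 1$, let $B_n$ be the braid group with standard generators $\sigma_1,\dots,\sigma_{n-1}$, and let $\mathscr H_n(z)$ be the $\mathbf Z[z]$-algebra with the generators and relations of the group $B_n$ and the additional relations $\sigma_i-\sigma_i^{-1}=z$. Let $\mathrm{Tr}\colon\mathscr H_n(z)\to\mathbf Z[z,T]$, $n=1,2,\dots$, be Ocneanu's trace, that is, the unique family of $\mathbf Z[z]$-linear maps, compatible with the maps $\mathscr H_n(z)\to\mathscr H_{n+1}(z)$, $\sigma_i\mapsto\sigma_i$, such that $\mathrm{Tr}(1)=1$, $\mathrm{Tr}(xy)=\mathrm{Tr}(yx)$ and $\mathrm{Tr}(x\sigma_n)=T\,\mathrm{Tr}(x)$ for $x\in\mathscr H_n(z)$. For $\beta\in B_n$ put \[H_\beta(v,z)=\left(\frac{v^{-1}-v}{z}\right)^{n-1}\mathrm{Tr}(\beta)\Big|_{T=z/(1-v^2)},\] let $L_\beta(z)$ be $z^{n-1}$ times the coefficient of $v^{1-n}$ in $H_\beta$, let $\beta^*$ be the braid obtained by writing the letters of a word for $\beta$ in reverse order, and put $\langle\alpha,\beta\rangle_L=L_{\alpha\beta^*}(z)$.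 For $\pi\in S_n$ let $\nu_\pi=\sigma_{i_1}^{-1}\cdots\sigma_{i_l}^{-1}$ be the negative permutation braid of $\pi$, where $s_{i_1}\cdots s_{i_l}$ is a reduced word for $\pi$ in the transpositions $s_i=(i\ \,i{+}1)$. (1) The elements $\nu_\pi$, $\pi\in S_n$, form a basis of the $\mathbf Z[z]$-module $\mathscr H_n(z)$. For every $\beta\in B_n$, the coefficients $\langle\beta,\nu_\pi\rangle_L$ lie in $\mathbf Z[z]$, and \[\beta=\sum_{\pi\in S_n}\langle\beta,\nu_\pi\rangle_L\cdot\nu_\pi\quad\text{in }\mathscr H_n(z).\] (2) Let $\beta$ be a positive braid, given by a word in the $\sigma_i$, and let $\pi\in S_n$. Let $f_{\beta,\pi}$ be the following oriented Legendrian front with $2n$ cusps, which represents the closure of $\beta\nu_\pi^*$. On the left it has $n$ nested left cusps, with the upper $n$ strands oriented to the right and the lower $n$ strands oriented to the left. The word $\beta$ is drawn horizontally in the lower $n$ strands, read along their orientation, with $\sigma_i$ crossing the $i$-th and the $(i+1)$-st of them counted from the top. On the right, the $a$-th upper strand counted from the bottom and the $\pi(a)$-th lower strand counted from the top meet in a right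 cusp, for $a=1,\dots,n$. Two of these strands cross to the right of $\beta$ only if one of them, say the $a$-th, is an upper strand and the other, say the $b$-th, is a lower strand, with $b<\pi(a)$ and $a<\pi^{-1}(b)$; in that case they cross exactly once. Then \[\langle\beta,\nu_\pi\rangle_L=z^{n-1}R_{f_{\beta,\pi}}(z),\] where $R_f(z)=\sum_S z^{1-C+|S|}$ is the oriented ruling polynomial of a front $f$ with $2C$ cusps. Here the sum is over the oriented rulings $S$ of $f$, that is, the sets $S$ of positive crossings of $f$ with the following properties. After all crossings in $S$ are smoothed (into two arcs without vertical tangents), the diagram is a union of eyes, which are simple closed curves with exactly one left and one right cusp each. The two arcs at a smoothed crossing belong to different eyes, and on the vertical line through that crossing the segments in the interiors of these two eyes are disjoint or one contains the other. -/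

import Mathlib

open scoped Polynomial LaurentPolynomial

noncomputable section

/-! ### Braid groups

`BraidGroup m` is Artin's group of braids on `n = m + 1` strands. Its standard generators
`σ_1, …, σ_{n-1}` are indexed from `0` by `Fin m`. -/

/-- The relators of Artin's presentation: `σ_i σ_j = σ_j σ_i` for `|i - j| ≥ 2` and
`σ_i σ_{i+1} σ_i = σ_{i+1} σ_i σ_{i+1}`. -/
def braidRels (m : ℕ) : Set (FreeGroup (Fin m)) :=
  {r | ∃ i j : Fin m, (i : ℕ) + 2 ≤ j ∧
      r = FreeGroup.of i * FreeGroup.of j * (FreeGroup.of j * FreeGroup.of i)⁻¹} ∪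
  {r | ∃ i j : Fin m, (i : ℕ) + 1 = j ∧
      r = FreeGroup.of i * FreeGroup.of j * FreeGroup.of i *
        (FreeGroup.of j * FreeGroup.of i * FreeGroup.of j)⁻¹}

/-- The braid group on `m + 1` strands. -/
abbrev BraidGroup (m : ℕ) : Type := PresentedGroup (braidRels m)

/-- The standard (positive) generator `σ_i`. -/
def braidGen {m : ℕ} (i : Fin m) : BraidGroup m := PresentedGroup.of i

theorem braidGen_comm {m : ℕ} {i j : Fin m} (h : (i : ℕ) + 2 ≤ j) :
    braidGen i * braidGen j = braidGen j * braidGen i := by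
  have := PresentedGroup.one_of_mem (rels := braidRels m) (Or.inl ⟨i, j, h, rfl⟩)
  rw [map_mul, map_inv, mul_inv_eq_one] at this
  simp only [map_mul] at this
  exact this

theorem braidGen_braid {m : ℕ} {i j : Fin m} (h : (i : ℕ) + 1 = j) :
    braidGen i * braidGen j * braidGen i = braidGen j * braidGen i * braidGen j := by
  have := PresentedGroup.one_of_mem (rels := braidRels m) (Or.inr ⟨i, j, h, rfl⟩)
  rw [map_mul, map_inv, mul_inv_eq_one] at this
  simp only [map_mul] at this
  exact this

/-- A homomorphism out of the braid group, from images of the generators that satisfy the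
braid relations. -/
def braidLift {m : ℕ} {G : Type*} [Group G] (f : Fin m → G)
    (hcomm : ∀ i j : Fin m, (i : ℕ) + 2 ≤ j → f i * f j = f j * f i)
    (hbraid : ∀ i j : Fin m, (i : ℕ) + 1 = j → f i * f j * f i = f j * f i * f j) :
    BraidGroup m →* G :=
  PresentedGroup.toGroup (f := f) (by
    rintro r (⟨i, j, h, rfl⟩ | ⟨i, j, h, rfl⟩)
    · simp only [map_mul, map_inv, FreeGroup.lift_apply_of, mul_inv_eq_one]
      exact hcomm i j h
    · simp only [map_mul, map_inv, FreeGroup.lift_apply_of, mul_inv_eq_one]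
      exact hbraid i j h)

theorem braidLift_braidGen {m : ℕ} {G : Type*} [Group G] (f : Fin m → G)
    (hcomm : ∀ i j : Fin m, (i : ℕ) + 2 ≤ j → f i * f j = f j * f i)
    (hbraid : ∀ i j : Fin m, (i : ℕ) + 1 = j → f i * f j * f i = f j * f i * f j) (i : Fin m) :
    braidLift f hcomm hbraid (braidGen i) = f i :=
  PresentedGroup.toGroup.of _

/-- The standard inclusion of the group of braids on `m + 1` strands in that on `m + 2` strands,
`σ_i ↦ σ_i`. -/
def braidIncl (m : ℕ) : BraidGroup m →* BraidGroup (m + 1) :=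
  braidLift (fun i => braidGen i.castSucc) (fun _ _ h => braidGen_comm h)
    (fun _ _ h => braidGen_braid h)

theorem braidIncl_braidGen {m : ℕ} (i : Fin m) :
    braidIncl m (braidGen i) = braidGen i.castSucc :=
  braidLift_braidGen _ _ _ i

/-- The anti-automorphism that fixes every `σ_i`, as a homomorphism to the opposite group. -/
def braidRevHom (m : ℕ) : BraidGroup m →* (BraidGroup m)ᵐᵒᵖ :=
  braidLift (fun i => MulOpposite.op (braidGen i))
    (fun i j h => by
      rw [← MulOpposite.op_mul, ← MulOpposite.op_mul, braidGen_comm h])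
    (fun i j h => by
      simp only [← MulOpposite.op_mul, ← mul_assoc]
      rw [braidGen_braid h])

/-- The reverse `β*` of a braid `β`: the letters `σ_i^{±1}` of a word for `β` are written in
reverse order (without inverting them). -/
def braidRev {m : ℕ} (β : BraidGroup m) : BraidGroup m := (braidRevHom m β).unop

/-- The positive braid with the word `σ_{i_1} ⋯ σ_{i_l}`. -/
def positiveBraid {m : ℕ} (w : List (Fin m)) : BraidGroup m := (w.map braidGen).prod

/-! ### Negative permutation braids -/

/-- The adjacent transposition `s_i = (i  i+1)`. -/
def adjSwap {m : ℕ} (i : Fin m) : Equiv.Perm (Fin (m + 1)) := Equiv.swap i.castSucc i.succ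

theorem exists_adjSwap_word {m : ℕ} (π : Equiv.Perm (Fin (m + 1))) :
    ∃ l : List (Fin m), (l.map adjSwap).prod = π := by
  have h : π ∈ Submonoid.closure
      (Set.range fun i : Fin m => Equiv.swap i.castSucc i.succ) := by
    rw [Equiv.Perm.mclosure_swap_castSucc_succ]; trivial
  induction h using Submonoid.closure_induction with
  | mem x hx => obtain ⟨i, rfl⟩ := hx; exact ⟨[i], by simp [adjSwap]⟩
  | one => exact ⟨[], rfl⟩
  | mul x y _ _ hx hy =>
    obtain ⟨l, rfl⟩ := hx
    obtain ⟨l', rfl⟩ := hy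
    exact ⟨l ++ l', by simp⟩

/-- `l` is a reduced word for `π`: `π = s_{i_1} ⋯ s_{i_l}`, with as few letters as possible. -/
def IsReducedWord {m : ℕ} (l : List (Fin m)) (π : Equiv.Perm (Fin (m + 1))) : Prop :=
  (l.map adjSwap).prod = π ∧
    ∀ l' : List (Fin m), (l'.map adjSwap).prod = π → l.length ≤ l'.length

theorem exists_isReducedWord {m : ℕ} (π : Equiv.Perm (Fin (m + 1))) :
    ∃ l : List (Fin m), IsReducedWord l π := by
  obtain ⟨l, hl, hmin⟩ := (measure (fun l : List (Fin m) => l.length)).wf.has_min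
    {l | (l.map adjSwap).prod = π} (exists_adjSwap_word π)
  exact ⟨l, hl, fun l' hl' => not_lt.mp (hmin l' hl')⟩

/-- The negative permutation braid `ν_π = σ_{i_1}⁻¹ ⋯ σ_{i_l}⁻¹`, where `s_{i_1} ⋯ s_{i_l}` is a
reduced word for `π`: the braid with permutation `π` all of whose crossings are negative and any
two of whose strands cross at most once. (By Matsumoto's theorem it does not depend on the
reduced word.) -/
def negPermBraid {m : ℕ} (π : Equiv.Perm (Fin (m + 1))) : BraidGroup m :=
  ((exists_isReducedWord π).choose.map fun i => (braidGen i)⁻¹).prod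

/-! ### The Hecke algebra

The ground ring `ℤ[z]` is `ℤ[X]`. -/

/-- The defining relations `σ_i - σ_i⁻¹ = z` in the group algebra of the braid group. -/
inductive HeckeRel (m : ℕ) :
    MonoidAlgebra ℤ[X] (BraidGroup m) → MonoidAlgebra ℤ[X] (BraidGroup m) → Prop
  | skein (i : Fin m) : HeckeRel m
      (MonoidAlgebra.of ℤ[X] _ (braidGen i) - MonoidAlgebra.of ℤ[X] _ (braidGen i)⁻¹)
      (algebraMap ℤ[X] _ Polynomial.X)

/-- The Hecke algebra `H_n(z)`, `n = m + 1`: the `ℤ[z]`-algebra with the generators and relations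
of the braid group on `n` strands and the further relations `σ_i - σ_i⁻¹ = z`. -/
abbrev HeckeAlgebra (m : ℕ) : Type := RingQuot (HeckeRel m)

/-- The natural representation of the braid group in the Hecke algebra. -/
def toHecke (m : ℕ) : BraidGroup m →* HeckeAlgebra m :=
  ((RingQuot.mkAlgHom ℤ[X] (HeckeRel m) : MonoidAlgebra ℤ[X] (BraidGroup m) →* HeckeAlgebra m)).comp
    (MonoidAlgebra.of ℤ[X] (BraidGroup m))

theorem toHecke_skein {m : ℕ} (i : Fin m) :
    toHecke m (braidGen i) - toHecke m (braidGen i)⁻¹ =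
      algebraMap ℤ[X] (HeckeAlgebra m) Polynomial.X := by
  have h := RingQuot.mkAlgHom_rel ℤ[X] (HeckeRel.skein i)
  rw [map_sub, AlgHom.commutes] at h
  exact h

/-- The standard homomorphism `H_n(z) → H_{n+1}(z)`, `σ_i ↦ σ_i`. -/
def heckeIncl (m : ℕ) : HeckeAlgebra m →ₐ[ℤ[X]] HeckeAlgebra (m + 1) :=
  RingQuot.liftAlgHom ℤ[X]
    ⟨MonoidAlgebra.lift ℤ[X] (HeckeAlgebra (m + 1)) (BraidGroup m)
        ((toHecke (m + 1)).comp (braidIncl m)), by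
      rintro _ _ ⟨i⟩
      rw [map_sub, AlgHom.commutes, MonoidAlgebra.lift_of, MonoidAlgebra.lift_of,
        MonoidHom.comp_apply, MonoidHom.comp_apply, map_inv, braidIncl_braidGen]
      exact toHecke_skein i.castSucc⟩

/-! ### Ocneanu's trace and the framed Homfly polynomial -/

/-- The properties that define Ocneanu's trace `Tr : H_n(z) → ℤ[z, T]`, `n = 1, 2, …`: it is
`ℤ[z]`-linear, compatible with the maps `H_n(z) → H_{n+1}(z)`, and satisfies `Tr(1) = 1`,
`Tr(xy) = Tr(yx)` and `Tr(x σ_n) = T · Tr(x)` for `x` from `H_n(z)`. The ring `ℤ[z, T]` is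
`ℤ[X][X]`, with `T` the outer variable. -/
structure IsOcneanuTrace (tr : ∀ m : ℕ, HeckeAlgebra m →ₗ[ℤ[X]] ℤ[X][X]) : Prop where
  map_one : ∀ m, tr m 1 = 1
  mul_comm : ∀ m (x y : HeckeAlgebra m), tr m (x * y) = tr m (y * x)
  incl : ∀ m (x : HeckeAlgebra m), tr (m + 1) (heckeIncl m x) = tr m x
  markov : ∀ m (x : HeckeAlgebra m),
    tr (m + 1) (heckeIncl m x * toHecke (m + 1) (braidGen (Fin.last m))) =
      Polynomial.X * tr m x

/-- Ocneanu's trace: the family of functionals with the properties `IsOcneanuTrace`. -/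
def ocneanuTrace : ∀ m : ℕ, HeckeAlgebra m →ₗ[ℤ[X]] ℤ[X][X] :=
  Classical.epsilon IsOcneanuTrace

/-- Laurent series in `v` with coefficients in `ℤ[z, z⁻¹]`. -/
abbrev HomflyRing : Type := LaurentSeries ℤ[T;T⁻¹]

namespace HomflyRing

/-- The variable `v`. -/
def v : HomflyRing := HahnSeries.single 1 1

/-- The inverse of `v`. -/
def vInv : HomflyRing := HahnSeries.single (-1) 1

/-- The variable `z`. -/
def z : HomflyRing := HahnSeries.C (LaurentPolynomial.T 1)

/-- The inverse of `z`. -/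
def zInv : HomflyRing := HahnSeries.C (LaurentPolynomial.T (-1))

/-- The inclusion of `ℤ[z]`. -/
def ofPoly : ℤ[X] →+* HomflyRing := HahnSeries.C.comp Polynomial.toLaurent

/-- `1 - v²` is invertible, so that `Ring.inverse` below is the true inverse. -/
theorem isUnit_one_sub_v_sq : IsUnit (1 - v ^ 2 : HomflyRing) := by
  have h : IsUnit (1 - PowerSeries.X ^ 2 : PowerSeries ℤ[T;T⁻¹]) := by
    rw [PowerSeries.isUnit_iff_constantCoeff]
    simp
  have h2 := h.map (HahnSeries.ofPowerSeries ℤ ℤ[T;T⁻¹])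
  rw [map_sub, map_one, map_pow, HahnSeries.ofPowerSeries_X] at h2
  exact h2

end HomflyRing

open HomflyRing in
/-- The framed Homfly polynomial `H_β(v, z) = ((v⁻¹ - v) / z)^(n-1) · Tr(β)|_{T = z / (1 - v²)}`,
`n = m + 1`, written as a Laurent series in `v`. -/
def framedHomfly {m : ℕ} (β : BraidGroup m) : HomflyRing :=
  ((vInv - v) * zInv) ^ m *
    Polynomial.eval₂ ofPoly (z * Ring.inverse (1 - v ^ 2)) (ocneanuTrace m (toHecke m β))

/-- The left column `L_β(z)`: `z^(n-1)` times the coefficient of `v^(1-n)` in `H_β(v, z)`,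
`n = m + 1`. -/
def leftColumn {m : ℕ} (β : BraidGroup m) : ℤ[T;T⁻¹] :=
  LaurentPolynomial.T (m : ℤ) * (framedHomfly β).coeff (-(m : ℤ))

/-- The left inner product `⟨α, β⟩_L = L_{αβ*}(z)` of two braids. -/
def leftInner {m : ℕ} (α β : BraidGroup m) : ℤ[T;T⁻¹] := leftColumn (α * braidRev β)

/-! ### Legendrian fronts and rulings

A generic oriented front is encoded, up to planar isotopy, by the list of its cusps and crossings
from left to right. Between two consecutive events the front consists of finitely many strands,
which are numbered `0, 1, 2, …` from the bottom to the top. -/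

/-- An event of a generic front. -/
inductive FrontEvent : Type
  /-- A left cusp, from which two new strands start, in the positions `k` and `k + 1`. The
  upper one is oriented to the right if `up` is true (then the lower one is oriented to the
  left), and to the left if `up` is false. -/
  | leftCusp (k : ℕ) (up : Bool) : FrontEvent
  /-- A crossing of the strands in the positions `k` and `k + 1`. -/
  | crossing (k : ℕ) : FrontEvent
  /-- A right cusp, where the strands in the positions `k` and `k + 1` end. -/
  | rightCusp (k : ℕ) : FrontEvent

/-- The strands, from bottom to top, just before the event number `i` of the diagram obtained from
`f` by smoothing the crossings whose event number is in `S` into two arcs without vertical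
tangents (so that the upper strand stays above the lower one). A strand is labelled by the event
number of the left cusp from which it comes, and by whether it is the upper (`true`) or the lower
(`false`) strand of that cusp. -/
def frontStrands (f : List FrontEvent) (S : Finset ℕ) : ℕ → List (ℕ × Bool)
  | 0 => []
  | i + 1 =>
    let l := frontStrands f S i
    match f[i]? with
    | some (.leftCusp k _) => l.take k ++ [(i, false), (i, true)] ++ l.drop k
    | some (.crossing k) =>
        if i ∈ S then l else l.take k ++ ((l.drop k).take 2).reverse ++ l.drop (k + 2)
    | some (.rightCusp k) => l.take k ++ l.drop (k + 2)
    | none => l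

/-- Whether the strand with the given label is oriented to the right. -/
def strandRightward (f : List FrontEvent) (s : ℕ × Bool) : Bool :=
  match f[s.1]? with
  | some (.leftCusp _ up) => s.2 == up
  | _ => false

/-- Whether, in the front `f`, the strand in position `k` just before event number `i` is oriented
to the right (`none` if there is no such strand). -/
def directionAt (f : List FrontEvent) (i k : ℕ) : Option Bool :=
  ((frontStrands f ∅ i)[k]?).map (strandRightward f)

/-- `f` really describes an oriented front of a closed link: cusps and crossings take place at
existing positions, the orientations of the two strands that meet at a right cusp fit together,
and no strand is left at the end. -/
structure IsOrientedFront (f : List FrontEvent) : Prop where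
  leftCusp : ∀ i k up, f[i]? = some (.leftCusp k up) → k ≤ (frontStrands f ∅ i).length
  crossing : ∀ i k, f[i]? = some (.crossing k) → k + 1 < (frontStrands f ∅ i).length
  rightCusp : ∀ i k, f[i]? = some (.rightCusp k) → k + 1 < (frontStrands f ∅ i).length ∧
    directionAt f i k ≠ directionAt f i (k + 1)
  closed : frontStrands f ∅ f.length = []

/-- Event number `i` is a positive crossing. In a front the strand with the lower slope is the
overcrossing one, hence a crossing is positive if and only if its two strands are both oriented to
the right or both to the left. -/
def IsPositiveCrossing (f : List FrontEvent) (i : ℕ) : Prop :=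
  ∃ k, f[i]? = some (.crossing k) ∧ directionAt f i k = directionAt f i (k + 1)

/-- The left cusp (as event number) of the eye to which the strand in position `k` belongs, just
before event number `i`, after the smoothing of `S`. Eyes are named after their left cusps. -/
def eyeAt (f : List FrontEvent) (S : Finset ℕ) (i k : ℕ) : Option ℕ :=
  ((frontStrands f S i)[k]?).map Prod.fst

/-- The segment in which the vertical line at event number `i` meets the interior of the eye `e`,
after the smoothing of `S`. It is the set of the intervals `[h, h + 1]` between consecutive
positions that lie between two strands of `e`; such an interval is given by its lower end. -/
def eyeSegment (f : List FrontEvent) (S : Finset ℕ) (i : ℕ) (e : Option ℕ) : Set ℕ :=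
  {h | ∃ a b, a ≤ h ∧ h < b ∧ b < (frontStrands f S i).length ∧
    eyeAt f S i a = e ∧ eyeAt f S i b = e}

/-- `S` (a set of event numbers) is an oriented ruling of the front `f`. -/
structure IsOrientedRuling (f : List FrontEvent) (S : Finset ℕ) : Prop where
  /-- `S` consists of positive crossings. -/
  positive : ∀ i ∈ S, IsPositiveCrossing f i
  /-- After the smoothing of `S`, every component has exactly one left and one right cusp: the two
  strands that meet at a right cusp come from the same left cusp. -/
  cusps : ∀ i k, f[i]? = some (.rightCusp k) → eyeAt f S i k = eyeAt f S i (k + 1)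
  /-- After the smoothing of `S`, every component is a simple curve: at a remaining crossing, the
  two strands belong to different components. -/
  simple : ∀ i k, f[i]? = some (.crossing k) → i ∉ S → eyeAt f S i k ≠ eyeAt f S i (k + 1)
  /-- The two arcs at a smoothed crossing belong to different eyes. -/
  switch : ∀ i k, f[i]? = some (.crossing k) → i ∈ S → eyeAt f S i k ≠ eyeAt f S i (k + 1)
  /-- On the vertical line through a smoothed crossing, the segments in the interiors of the two
  eyes that meet there are disjoint or one contains the other. -/
  normal : ∀ i k, f[i]? = some (.crossing k) → i ∈ S →
    Disjoint (eyeSegment f S i (eyeAt f S i k)) (eyeSegment f S i (eyeAt f S i (k + 1))) ∨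
    eyeSegment f S i (eyeAt f S i k) ⊆ eyeSegment f S i (eyeAt f S i (k + 1)) ∨
    eyeSegment f S i (eyeAt f S i (k + 1)) ⊆ eyeSegment f S i (eyeAt f S i k)

/-- Whether an event is a right cusp. -/
def FrontEvent.isRightCusp : FrontEvent → Bool
  | .rightCusp _ => true
  | _ => false

open Classical in
/-- The oriented ruling polynomial of the front `f` with `2C` cusps (`C` of them right cusps): the
sum of `z^(1 - θ)`, `θ = C - |S|`, over all oriented rulings `S` of `f`. -/
def rulingPolynomial (f : List FrontEvent) : ℤ[T;T⁻¹] :=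
  ∑ S ∈ (Finset.range f.length).powerset with IsOrientedRuling f S,
    LaurentPolynomial.T (1 - ((f.countP FrontEvent.isRightCusp : ℤ) - (S.card : ℤ)))

/-! ### The front of a positive braid and a negative permutation braid -/

/-- The Legendrian tangle `T_ρ` realizing `ν_ρ`, `ρ` in `S_n`, `n = m + 1`, with its left cusps
missing.

It has `2n` ends, all on its left. Number the `n` upper ends `0, …, m` from the bottom to the top,
and the `n` lower ends `0, …, m` from the top to the bottom. The dots (right cusps) are those of
the permutation matrix of `ρ`: from the dot with the coordinates `(ρ b, b)` a segment goes
northwest to the upper end `ρ b` and a segment goes southwest to the lower end `b`. Hence the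
northwest segment from the upper end `a` crosses the southwest segment from the lower end `b` if
and only if `b < ρ⁻¹ a` and `a < ρ b`. The events are listed for `a = 0`, then for `a = 1`, and so
on: the strand from the upper end `a` comes down, crosses all the remaining strands from lower
ends `b < ρ⁻¹ a`, and meets the strand from the lower end `ρ⁻¹ a` in a cusp. Before this, there
are `n - a` remaining strands from lower ends, all of them below the strand from the upper end
`a`. -/
def permTangle {m : ℕ} (ρ : Equiv.Perm (Fin (m + 1))) : List FrontEvent :=
  (List.finRange (m + 1)).flatMap fun a =>
    let r := (Finset.univ.filter fun b : Fin (m + 1) => b < ρ⁻¹ a ∧ a < ρ b).card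
    (List.range r).map (fun t => FrontEvent.crossing ((m - a) - t)) ++
      [FrontEvent.rightCusp ((m - a) - r)]

/-- The front with `2n` cusps, `n = m + 1`, built from the positive braid word
`w = σ_{i_1} ⋯ σ_{i_l}` and the permutation `π`. From left to right it consists of

* `n` nested left cusps, whose `n` upper strands are oriented to the right and whose `n` lower
  strands are oriented to the left;
* the braid `w`, drawn horizontally in the lower `n` strands with a front crossing for every
  letter; as these strands are oriented to the left, the last letter is the leftmost one, and
  `σ_i` crosses the lower strands number `i` and `i + 1`, which are numbered from the top (that
  is, it crosses the positions `m - 1 - i` and `m - i`);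
* the tangle `T_ρ` for `ρ = π⁻¹`, which realizes `ν_ρ = (ν_π)*`.

It is a front of the closure of the braid `β (ν_π)*`, where `β` is the braid of `w`. -/
def braidPermFront {m : ℕ} (w : List (Fin m)) (π : Equiv.Perm (Fin (m + 1))) :
    List FrontEvent :=
  (List.range (m + 1)).map (fun k => FrontEvent.leftCusp k true) ++
    w.reverse.map (fun i => FrontEvent.crossing (Fin.rev i : ℕ)) ++
    permTangle π⁻¹

end

noncomputable section

/-! Let the Hecke algebra act on the free module with basis `e_v`, `v ∈ S_n` (`PermModule`), by the
formulas for left multiplication in the sought basis, with `e_v` in the role of `ν_{v⁻¹}`. Thus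
`σ_i⁻¹` sends `e_v` to `e_{v s_i}` if `v(i) < v(i+1)`, and to `e_{v s_i} - z e_v` otherwise
(`negOp`). By the exchange property, every letter of a reduced word acts at an ascent, so `h ↦ h
e_1` (`heckeCoord`) takes `ν_π` to `e_{π⁻¹}` and is onto. It is injective by a count of ranks. Since
`H_{n+1} = H_n + H_n σ_n⁻¹ H_n`, the algebra `H_{n+1}` is spanned over `H_n` by `n + 1` elements. By
induction it is therefore an image of a free module of rank `(n+1)!`, and a surjection between free
modules of the same finite rank is bijective. Besides the basis, this yields a normal form over
`H_n`, on which Ocneanu's trace is defined by recursion.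

In the lowest power of `v`, the substitution `T = z/(1 - v²)` becomes `T = z`. There the trace of
`σ_n⁻¹ = σ_n - z` vanishes, so `L_β` is just the coefficient of `e_1` in `β e_1`
(`IsOcneanuTrace.eval_eq`, `leftColumn_eq`). The operators of the `σ_i` are symmetric for the
standard dot product, hence `β*` acts as the adjoint of `β`. Therefore `⟨β, ν_π⟩_L = ⟨ν_π e_1, β
e_1⟩` is the coefficient of `e_{π⁻¹}` in `β e_1` (`leftInner_negPermBraid`), which is the expansion
of `β`.

In the front, the eyes in the braid part are recorded by a permutation `v`: the lower end `b`
belongs to the eye of the upper end `v b`. A crossing `σ_j` that is kept replaces `v` by `v s_j`. A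
smoothed one keeps `v`, and since all eyes overlap in the middle, normality says that they are
nested, that is, `v(j) < v(j+1)` (`rulingCond_permStrands`). The crossings of the tangle are
negative, and its cusps force the final permutation to be `π⁻¹`. So rulings are paths from `1` to
`π⁻¹` with a factor `z` for each step that stays at an ascent. These are exactly the terms of the
matrix coefficient of a product of operators `posOp` (`sum_paths`). -/

/-! ### Generators of the Hecke algebra -/

/-- The image of `σ_i⁻¹` in the Hecke algebra. -/
def heckeGen {m : ℕ} (i : Fin m) : HeckeAlgebra m := toHecke m (braidGen i)⁻¹

theorem toHecke_braidGen {m : ℕ} (i : Fin m) :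
    toHecke m (braidGen i) = heckeGen i + algebraMap ℤ[X] (HeckeAlgebra m) Polynomial.X := by
  rw [← toHecke_skein i, heckeGen]; abel

/-- The skein relation multiplied by `σ_i⁻¹`. -/
theorem heckeGen_mul_self {m : ℕ} (i : Fin m) :
    heckeGen i * heckeGen i = 1 + (-Polynomial.X : ℤ[X]) • heckeGen i := by
  have h : heckeGen i * toHecke m (braidGen i) = 1 := by
    rw [heckeGen, ← map_mul, inv_mul_cancel, map_one]
  rw [toHecke_braidGen, mul_add, ← Algebra.commutes, ← Algebra.smul_def] at h
  rw [← h, add_assoc, ← add_smul, add_neg_cancel, zero_smul, add_zero]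

theorem heckeGen_comm {m : ℕ} {i j : Fin m} (h : (i : ℕ) + 2 ≤ j) :
    heckeGen i * heckeGen j = heckeGen j * heckeGen i := by
  simp only [heckeGen, ← map_mul, ← mul_inv_rev, braidGen_comm h]

theorem heckeGen_braid {m : ℕ} {i j : Fin m} (h : (i : ℕ) + 1 = j) :
    heckeGen i * heckeGen j * heckeGen i = heckeGen j * heckeGen i * heckeGen j := by
  simp only [heckeGen, ← map_mul, ← mul_inv_rev, ← mul_assoc, braidGen_braid h]

theorem heckeIncl_toHecke {m : ℕ} (β : BraidGroup m) :
    heckeIncl m (toHecke m β) = toHecke (m + 1) (braidIncl m β) := by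
  refine (RingQuot.liftAlgHom_mkAlgHom_apply ℤ[X] _ _ _).trans ?_
  rw [MonoidAlgebra.lift_of, MonoidHom.comp_apply]

theorem heckeIncl_heckeGen {m : ℕ} (i : Fin m) :
    heckeIncl m (heckeGen i) = heckeGen i.castSucc := by
  rw [heckeGen, heckeIncl_toHecke, map_inv, braidIncl_braidGen, heckeGen]

/-- The elements `σ_i⁻¹` generate the Hecke algebra. -/
theorem adjoin_heckeGen (m : ℕ) :
    Algebra.adjoin ℤ[X] (Set.range (heckeGen : Fin m → HeckeAlgebra m)) = ⊤ := by
  set A := Algebra.adjoin ℤ[X] (Set.range (heckeGen : Fin m → HeckeAlgebra m)) with hA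
  have hgen : ∀ i : Fin m, heckeGen i ∈ A := fun i => Algebra.subset_adjoin ⟨i, rfl⟩
  have hgen' : ∀ i : Fin m, toHecke m (braidGen i) ∈ A := fun i => by
    rw [toHecke_braidGen]; exact A.add_mem (hgen i) (A.algebraMap_mem _)
  have hβ : ∀ w : FreeGroup (Fin m), toHecke m (PresentedGroup.mk (braidRels m) w) ∈ A := by
    intro w
    induction w using FreeGroup.induction_on with
    | C1 => rw [map_one, map_one]; exact A.one_mem
    | of i => exact hgen' i
    | inv_of i _ => rw [map_inv]; exact hgen i
    | mul x y hx hy => rw [map_mul, map_mul]; exact A.mul_mem hx hy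
  rw [eq_top_iff]
  rintro h -
  obtain ⟨f, rfl⟩ := RingQuot.mkAlgHom_surjective ℤ[X] (HeckeRel m) h
  induction f using MonoidAlgebra.induction_on with
  | of β =>
    obtain ⟨w, rfl⟩ := PresentedGroup.mk_surjective (braidRels m) β
    exact hβ w
  | add x y hx hy => rw [map_add]; exact A.add_mem hx hy
  | smul r x hx => rw [map_smul]; exact A.smul_mem hx r

/-- An additive, multiplicative property that holds for scalars and for all `σ_i⁻¹` holds on the
Hecke algebra. -/
theorem HeckeAlgebra.induction {m : ℕ} {p : HeckeAlgebra m → Prop}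
    (algebraMap : ∀ r, p (algebraMap ℤ[X] _ r)) (gen : ∀ i, p (heckeGen i))
    (add : ∀ x y, p x → p y → p (x + y)) (mul : ∀ x y, p x → p y → p (x * y))
    (h : HeckeAlgebra m) : p h := by
  have hh : h ∈ Algebra.adjoin ℤ[X] (Set.range (heckeGen : Fin m → HeckeAlgebra m)) := by
    rw [adjoin_heckeGen]; trivial
  induction hh using Algebra.adjoin_induction with
  | mem x hx => obtain ⟨i, rfl⟩ := hx; exact gen i
  | algebraMap r => exact algebraMap r
  | add x y _ _ hx hy => exact add x y hx hy
  | mul x y _ _ hx hy => exact mul x y hx hy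

theorem HeckeAlgebra.exists_eq_algebraMap (h : HeckeAlgebra 0) :
    ∃ r, h = algebraMap ℤ[X] (HeckeAlgebra 0) r := by
  induction h using HeckeAlgebra.induction with
  | algebraMap r => exact ⟨r, rfl⟩
  | gen i => exact i.elim0
  | add x y hx hy =>
    obtain ⟨a, rfl⟩ := hx
    obtain ⟨b, rfl⟩ := hy
    exact ⟨a + b, (map_add _ _ _).symm⟩
  | mul x y hx hy =>
    obtain ⟨a, rfl⟩ := hx
    obtain ⟨b, rfl⟩ := hy
    exact ⟨a * b, (map_mul _ _ _).symm⟩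

/-! ### The Hecke algebra as a bimodule over the preceding one -/

/-- The last generator `σ_n⁻¹` of `H_{n+1}(z)`. -/
abbrev heckeLast (m : ℕ) : HeckeAlgebra (m + 1) := heckeGen (Fin.last m)

theorem heckeLast_commute {m : ℕ} (x : HeckeAlgebra m) :
    heckeLast (m + 1) * heckeIncl (m + 1) (heckeIncl m x) =
      heckeIncl (m + 1) (heckeIncl m x) * heckeLast (m + 1) := by
  induction x using HeckeAlgebra.induction with
  | algebraMap r => simp only [AlgHom.commutes, Algebra.commutes]
  | gen i =>
    rw [heckeIncl_heckeGen, heckeIncl_heckeGen]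
    refine (heckeGen_comm ?_).symm
    simp only [Fin.val_castSucc, Fin.val_last]
    omega
  | add x y hx hy => simp only [map_add, mul_add, add_mul, hx, hy]
  | mul x y hx hy => rw [map_mul, map_mul, ← mul_assoc, hx, mul_assoc, hy, mul_assoc]

theorem heckeLast_braid (m : ℕ) :
    heckeLast (m + 1) * heckeIncl (m + 1) (heckeLast m) * heckeLast (m + 1) =
      heckeIncl (m + 1) (heckeLast m) * heckeLast (m + 1) * heckeIncl (m + 1) (heckeLast m) := by
  rw [heckeIncl_heckeGen]
  exact (heckeGen_braid (by simp)).symm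

/-- `σ_n⁻¹ y' σ_{n-1}⁻¹ y'' σ_n⁻¹ = y' σ_{n-1}⁻¹ σ_n⁻¹ σ_{n-1}⁻¹ y''`. -/
theorem heckeLast_mul_mul_heckeLast {m : ℕ} (y y' : HeckeAlgebra m) :
    heckeLast (m + 1) * heckeIncl (m + 1) (heckeIncl m y * heckeLast m * heckeIncl m y') *
        heckeLast (m + 1) =
      heckeIncl (m + 1) (heckeIncl m y * heckeLast m) * heckeLast (m + 1) *
        heckeIncl (m + 1) (heckeLast m * heckeIncl m y') := by
  have h := heckeLast_commute y
  have h' := heckeLast_commute y'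
  have hb := heckeLast_braid m
  simp only [map_mul]
  generalize heckeIncl (m + 1) (heckeIncl m y) = a at *
  generalize heckeIncl (m + 1) (heckeIncl m y') = b at *
  generalize heckeIncl (m + 1) (heckeLast m) = c at *
  generalize heckeLast (m + 1) = d at *
  calc d * (a * c * b) * d = (d * a) * c * (b * d) := by simp only [mul_assoc]
    _ = a * (d * c * d) * b := by rw [h, ← h']; simp only [mul_assoc]
    _ = _ := by rw [hb]; simp only [mul_assoc]

/-- `σ_n⁻¹ y σ_n⁻¹ = y - z y σ_n⁻¹` for `y` from `H_{n-1}(z)`. -/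
theorem heckeLast_mul_incl_mul_heckeLast {m : ℕ} (y : HeckeAlgebra m) :
    heckeLast (m + 1) * heckeIncl (m + 1) (heckeIncl m y) * heckeLast (m + 1) =
      heckeIncl (m + 1) (heckeIncl m y) +
        (-Polynomial.X : ℤ[X]) • (heckeIncl (m + 1) (heckeIncl m y) * heckeLast (m + 1)) := by
  rw [heckeLast_commute, mul_assoc, heckeGen_mul_self, mul_add, mul_one, mul_smul_comm]

/-- The span of `H_n(z)` and `H_n(z) σ_n⁻¹ H_n(z)` in `H_{n+1}(z)`. -/
def heckeTwoSidedSpan (m : ℕ) : Submodule ℤ[X] (HeckeAlgebra (m + 1)) :=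
  Submodule.span ℤ[X] (Set.range (heckeIncl m) ∪
    Set.range fun p : HeckeAlgebra m × HeckeAlgebra m =>
      heckeIncl m p.1 * heckeLast m * heckeIncl m p.2)

theorem heckeIncl_mem_span {m : ℕ} (x : HeckeAlgebra m) : heckeIncl m x ∈ heckeTwoSidedSpan m :=
  Submodule.subset_span (Or.inl ⟨x, rfl⟩)

theorem heckeIncl_mul_mem_span {m : ℕ} (x y : HeckeAlgebra m) :
    heckeIncl m x * heckeLast m * heckeIncl m y ∈ heckeTwoSidedSpan m :=
  Submodule.subset_span (Or.inr ⟨(x, y), rfl⟩)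

theorem heckeIncl_mul_mem_span' {m : ℕ} (x : HeckeAlgebra m) {h : HeckeAlgebra (m + 1)}
    (hh : h ∈ heckeTwoSidedSpan m) : heckeIncl m x * h ∈ heckeTwoSidedSpan m := by
  induction hh using Submodule.span_induction with
  | mem h hh =>
    rcases hh with ⟨y, rfl⟩ | ⟨⟨y, y'⟩, rfl⟩
    · rw [← map_mul]; exact heckeIncl_mem_span _
    · rw [← mul_assoc, ← mul_assoc, ← map_mul]; exact heckeIncl_mul_mem_span _ _
  | zero => rw [mul_zero]; exact Submodule.zero_mem _
  | add a b _ _ ha hb => rw [mul_add]; exact Submodule.add_mem _ ha hb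
  | smul r a _ ha => rw [mul_smul_comm]; exact Submodule.smul_mem _ r ha

/-- The span contains `1` and is visibly stable under right multiplication by `H_n`. The products
`σ_n⁻¹ y σ_n⁻¹` are the only obstruction to its stability under `σ_n⁻¹`. -/
theorem heckeTwoSidedSpan_eq_top_of {m : ℕ}
    (H : ∀ y : HeckeAlgebra m, heckeLast m * heckeIncl m y * heckeLast m ∈ heckeTwoSidedSpan m) :
    heckeTwoSidedSpan m = ⊤ := by
  have key : ∀ h : HeckeAlgebra (m + 1), ∀ x ∈ heckeTwoSidedSpan m,
      x * h ∈ heckeTwoSidedSpan m := by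
    intro h
    induction h using HeckeAlgebra.induction with
    | algebraMap r =>
      intro x hx
      rw [← Algebra.commutes, ← Algebra.smul_def]
      exact Submodule.smul_mem _ r hx
    | gen i =>
      intro x hx
      induction hx using Submodule.span_induction with
      | mem x hx =>
        induction i using Fin.lastCases with
        | last =>
          rcases hx with ⟨y, rfl⟩ | ⟨⟨y, y'⟩, rfl⟩
          · simpa using heckeIncl_mul_mem_span y 1
          · have := heckeIncl_mul_mem_span' y (H y')
            simpa only [mul_assoc] using this
        | cast i =>
          rw [← heckeIncl_heckeGen]
          rcases hx with ⟨y, rfl⟩ | ⟨⟨y, y'⟩, rfl⟩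
          · rw [← map_mul]; exact heckeIncl_mem_span _
          · simp only []
            rw [mul_assoc, ← map_mul]; exact heckeIncl_mul_mem_span _ _
      | zero => rw [zero_mul]; exact Submodule.zero_mem _
      | add a b _ _ ha hb => rw [add_mul]; exact Submodule.add_mem _ ha hb
      | smul r a _ ha => rw [smul_mul_assoc]; exact Submodule.smul_mem _ r ha
    | add x y hx hy => intro a ha; rw [mul_add]; exact Submodule.add_mem _ (hx a ha) (hy a ha)
    | mul x y hx hy => intro a ha; rw [← mul_assoc]; exact hy _ (hx a ha)
  rw [eq_top_iff]
  rintro h -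
  have := key h (heckeIncl m 1) (heckeIncl_mem_span 1)
  rwa [map_one, one_mul] at this

/-- By induction the middle factor `y` lies in `H_{n-1} + H_{n-1} σ_{n-1}⁻¹ H_{n-1}`. In `σ_n⁻¹ y
σ_n⁻¹`, the quadratic relation (first summand) or the braid relation (second) then leaves at most
one letter `σ_n⁻¹`. -/
theorem heckeTwoSidedSpan_eq_top (m : ℕ) : heckeTwoSidedSpan m = ⊤ := by
  induction m with
  | zero =>
    refine heckeTwoSidedSpan_eq_top_of fun y => ?_
    obtain ⟨r, rfl⟩ := y.exists_eq_algebraMap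
    rw [AlgHom.commutes, ← Algebra.commutes, mul_assoc, ← Algebra.smul_def, heckeGen_mul_self]
    refine Submodule.smul_mem _ r (Submodule.add_mem _ ?_ (Submodule.smul_mem _ _ ?_))
    · simpa using heckeIncl_mem_span (1 : HeckeAlgebra 0)
    · have := heckeIncl_mul_mem_span (1 : HeckeAlgebra 0) 1
      rwa [map_one, one_mul, mul_one] at this
  | succ m ih =>
    refine heckeTwoSidedSpan_eq_top_of fun y => ?_
    have hy : y ∈ heckeTwoSidedSpan m := by rw [ih]; trivial
    induction hy using Submodule.span_induction with
    | mem y hy =>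
      rcases hy with ⟨y, rfl⟩ | ⟨⟨y, y'⟩, rfl⟩
      · rw [heckeLast_mul_incl_mul_heckeLast]
        refine Submodule.add_mem _ (heckeIncl_mem_span _) (Submodule.smul_mem _ _ ?_)
        simpa using heckeIncl_mul_mem_span (heckeIncl m y) 1
      · simp only []
        rw [heckeLast_mul_mul_heckeLast]
        exact heckeIncl_mul_mem_span _ _
    | zero => simp
    | add a b _ _ ha hb => rw [map_add, mul_add, add_mul]; exact Submodule.add_mem _ ha hb
    | smul r a _ ha =>
      rw [map_smul, mul_smul_comm, smul_mul_assoc]; exact Submodule.smul_mem _ r ha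

/-- An additive property of elements of `H_{n+1}(z)` may be checked on `H_n(z)` and on
`H_n(z) σ_n⁻¹ H_n(z)`. -/
theorem HeckeAlgebra.succ_induction {m : ℕ} {p : HeckeAlgebra (m + 1) → Prop}
    (incl : ∀ x, p (heckeIncl m x)) (mid : ∀ x y, p (heckeIncl m x * heckeLast m * heckeIncl m y))
    (add : ∀ x y, p x → p y → p (x + y)) (h : HeckeAlgebra (m + 1)) : p h := by
  have hh : h ∈ heckeTwoSidedSpan m := by rw [heckeTwoSidedSpan_eq_top]; trivial
  -- `p` is not assumed to be stable under scalars. Proving it for all multiples at once works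
  -- because a scalar can be absorbed into the factor from `H_n(z)`.
  have : ∀ r : ℤ[X], p (r • h) := by
    induction hh using Submodule.span_induction with
    | mem h hh =>
      intro r
      rcases hh with ⟨y, rfl⟩ | ⟨⟨y, y'⟩, rfl⟩
      · rw [← map_smul]; exact incl _
      · simp only []
        rw [← smul_mul_assoc, ← smul_mul_assoc, ← map_smul]; exact mid _ _
    | zero => intro r; rw [smul_zero]; simpa using incl 0
    | add a b _ _ ha hb => intro r; rw [smul_add]; exact add _ _ (ha r) (hb r)
    | smul s a _ ha => intro r; rw [smul_smul]; exact ha _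
  simpa using this 1

/-! ### The regular representation -/

/-- The free `ℤ[z]`-module on the permutations. -/
abbrev PermModule (m : ℕ) : Type := Equiv.Perm (Fin (m + 1)) → ℤ[X]

/-- The basis vector of a permutation. -/
abbrev permVec {m : ℕ} (v : Equiv.Perm (Fin (m + 1))) : PermModule m := Pi.single v 1

/-- The operator of `σ_i⁻¹` on `PermModule m`. -/
def negOp {m : ℕ} (i : Fin m) : Module.End ℤ[X] (PermModule m) where
  toFun f v := f (v * adjSwap i) - if v i.succ < v i.castSucc then Polynomial.X * f v else 0
  map_add' f g := by ext1 v; simp only [Pi.add_apply]; split_ifs <;> ring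
  map_smul' r f := by
    ext1 v; simp only [Pi.smul_apply, smul_eq_mul, RingHom.id_apply]; split_ifs <;> ring

/-- The operator of `σ_i` on `PermModule m`. -/
def posOp {m : ℕ} (i : Fin m) : Module.End ℤ[X] (PermModule m) where
  toFun f v := f (v * adjSwap i) + if v i.castSucc < v i.succ then Polynomial.X * f v else 0
  map_add' f g := by ext1 v; simp only [Pi.add_apply]; split_ifs <;> ring
  map_smul' r f := by
    ext1 v; simp only [Pi.smul_apply, smul_eq_mul, RingHom.id_apply]; split_ifs <;> ring

theorem negOp_apply {m : ℕ} (i : Fin m) (f : PermModule m) (v : Equiv.Perm (Fin (m + 1))) :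
    negOp i f v =
      f (v * adjSwap i) - if v i.succ < v i.castSucc then Polynomial.X * f v else 0 := rfl

theorem posOp_apply {m : ℕ} (i : Fin m) (f : PermModule m) (v : Equiv.Perm (Fin (m + 1))) :
    posOp i f v =
      f (v * adjSwap i) + if v i.castSucc < v i.succ then Polynomial.X * f v else 0 := rfl

theorem adjSwap_mul_self {m : ℕ} (i : Fin m) : adjSwap i * adjSwap i = 1 :=
  Equiv.swap_mul_self _ _

theorem adjSwap_inv {m : ℕ} (i : Fin m) : (adjSwap i)⁻¹ = adjSwap i := Equiv.swap_inv _ _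

@[simp] theorem adjSwap_castSucc {m : ℕ} (i : Fin m) : adjSwap i i.castSucc = i.succ :=
  Equiv.swap_apply_left _ _

@[simp] theorem adjSwap_succ {m : ℕ} (i : Fin m) : adjSwap i i.succ = i.castSucc :=
  Equiv.swap_apply_right _ _

theorem adjSwap_of_ne {m : ℕ} {i : Fin m} {k : Fin (m + 1)} (h : k ≠ i.castSucc)
    (h' : k ≠ i.succ) : adjSwap i k = k :=
  Equiv.swap_apply_of_ne_of_ne h h'

theorem Equiv.Perm.lt_castSucc_iff_not {m : ℕ} (v : Equiv.Perm (Fin (m + 1))) (i : Fin m) :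
    v i.succ < v i.castSucc ↔ ¬ v i.castSucc < v i.succ := by
  have h : v i.castSucc ≠ v i.succ := v.injective.ne (Fin.castSucc_lt_succ).ne
  rw [not_lt]
  exact ⟨le_of_lt, fun h' => lt_of_le_of_ne h' h.symm⟩

theorem posOp_eq {m : ℕ} (i : Fin m) :
    posOp i = negOp i + algebraMap ℤ[X] (Module.End ℤ[X] (PermModule m)) Polynomial.X := by
  refine LinearMap.ext fun f => funext fun v => ?_
  rw [LinearMap.add_apply, Pi.add_apply, posOp_apply, negOp_apply, Module.algebraMap_end_apply,
    Pi.smul_apply, smul_eq_mul]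
  simp only [v.lt_castSucc_iff_not i]
  by_cases h : v i.castSucc < v i.succ <;> simp [h]

/-- An ascent of `v` at `i` is a descent of `v s_i` and conversely, so the two correction terms
cancel. -/
theorem negOp_mul_posOp {m : ℕ} (i : Fin m) : negOp i * posOp i = 1 := by
  refine LinearMap.ext fun f => funext fun v => ?_
  simp only [Module.End.mul_apply, Module.End.one_apply, posOp_apply, negOp_apply, mul_assoc,
    adjSwap_mul_self, mul_one, Equiv.Perm.mul_apply, adjSwap_castSucc, adjSwap_succ]
  simp only [v.lt_castSucc_iff_not i]
  by_cases h : v i.castSucc < v i.succ <;> simp [h]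

theorem posOp_mul_negOp {m : ℕ} (i : Fin m) : posOp i * negOp i = 1 := by
  rw [← negOp_mul_posOp i, posOp_eq, mul_add, add_mul, Algebra.commutes]

theorem adjSwap_comm {m : ℕ} {i j : Fin m} (h : (i : ℕ) + 2 ≤ j) :
    adjSwap i * adjSwap j = adjSwap j * adjSwap i := by
  refine (Equiv.Perm.Disjoint.commute ?_).eq
  intro k
  by_cases hk : k = i.castSucc ∨ k = i.succ
  · right
    refine adjSwap_of_ne ?_ ?_ <;> rcases hk with rfl | rfl <;> simp [Fin.ext_iff] <;> omega
  · left
    push Not at hk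
    exact adjSwap_of_ne hk.1 hk.2

theorem adjSwap_braid {m : ℕ} {i j : Fin m} (h : (i : ℕ) + 1 = j) :
    adjSwap i * adjSwap j * adjSwap i = adjSwap j * adjSwap i * adjSwap j := by
  have h1 : j.castSucc = i.succ := by ext; simp [← h]
  have hi : i.castSucc ≠ i.succ := (Fin.castSucc_lt_succ).ne
  have hj : i.succ ≠ j.succ := by rw [← h1]; exact (Fin.castSucc_lt_succ).ne
  have hij : i.castSucc ≠ j.succ := by simp [Fin.ext_iff]; omega
  have hl := Equiv.swap_mul_swap_mul_swap hj.symm hij.symm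
  have hr := Equiv.swap_mul_swap_mul_swap hi hij
  rw [Equiv.swap_comm i.succ i.castSucc, Equiv.swap_comm j.succ i.succ] at hl
  rw [adjSwap, adjSwap, h1, hl, hr, Equiv.swap_comm]

theorem posOp_comm {m : ℕ} {i j : Fin m} (h : (i : ℕ) + 2 ≤ j) :
    posOp i * posOp j = posOp j * posOp i := by
  refine LinearMap.ext fun f => funext fun v => ?_
  have h1 : adjSwap i j.castSucc = j.castSucc := by
    refine adjSwap_of_ne ?_ ?_ <;> simp [Fin.ext_iff] <;> omega
  have h2 : adjSwap i j.succ = j.succ := by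
    refine adjSwap_of_ne ?_ ?_ <;> simp [Fin.ext_iff] <;> omega
  have h3 : adjSwap j i.castSucc = i.castSucc := by
    refine adjSwap_of_ne ?_ ?_ <;> simp [Fin.ext_iff] <;> omega
  have h4 : adjSwap j i.succ = i.succ := by
    refine adjSwap_of_ne ?_ ?_ <;> simp [Fin.ext_iff] <;> omega
  simp only [Module.End.mul_apply, posOp_apply, mul_assoc, Equiv.Perm.mul_apply, h1, h2, h3, h4,
    adjSwap_comm h]
  split_ifs <;> ring

/-- At `v`, both sides involve `f` only on the coset of `v` under `⟨s_i, s_j⟩`, with coefficients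
that depend only on the relative order of three values of `v`. Of the eight sign patterns of the
comparisons, two are cyclic and impossible, and the other six are checked. -/
theorem posOp_braid {m : ℕ} {i j : Fin m} (h : (i : ℕ) + 1 = j) :
    posOp i * posOp j * posOp i = posOp j * posOp i * posOp j := by
  have h1 : j.castSucc = i.succ := by ext; simp [← h]
  have h2 : adjSwap i j.succ = j.succ := by
    refine adjSwap_of_ne ?_ ?_ <;> simp [Fin.ext_iff] <;> omega
  have h3 : adjSwap j i.castSucc = i.castSucc := by
    refine adjSwap_of_ne ?_ ?_ <;> simp [Fin.ext_iff] <;> omega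
  have h4 : adjSwap j i.succ = j.succ := by rw [← h1, adjSwap_castSucc]
  have h5 : adjSwap j j.succ = i.succ := by rw [adjSwap_succ, h1]
  have hb := adjSwap_braid h
  simp only [mul_assoc] at hb
  refine LinearMap.ext fun f => funext fun v => ?_
  simp only [Module.End.mul_apply, posOp_apply, mul_assoc, Equiv.Perm.mul_apply, h1, h2, h3, h4,
    h5, adjSwap_castSucc, adjSwap_succ, adjSwap_mul_self, mul_one, hb]
  have ha : v i.castSucc ≠ v i.succ := v.injective.ne (Fin.castSucc_lt_succ).ne
  have hc : v i.succ ≠ v j.succ := v.injective.ne (by rw [← h1]; exact (Fin.castSucc_lt_succ).ne)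
  have hac : v i.castSucc ≠ v j.succ := v.injective.ne (by simp [Fin.ext_iff]; omega)
  generalize v i.castSucc = a at *
  generalize v i.succ = b at *
  generalize v j.succ = c at *
  rcases lt_or_gt_of_ne ha with hab | hab <;> rcases lt_or_gt_of_ne hc with hbc | hbc <;>
    rcases lt_or_gt_of_ne hac with hac | hac <;>
    first
    | exact absurd (hab.trans hbc) hac.not_gt
    | exact absurd (hbc.trans hab) hac.not_gt
    | (simp only [hab, hbc, hac, hab.not_gt, hbc.not_gt, hac.not_gt, if_true, if_false] <;> ring)

/-- The operator of `σ_i` as a unit. -/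
def posUnit {m : ℕ} (i : Fin m) : (Module.End ℤ[X] (PermModule m))ˣ :=
  ⟨posOp i, negOp i, posOp_mul_negOp i, negOp_mul_posOp i⟩

/-- The action of the braid group on `PermModule m`. -/
def braidRep (m : ℕ) : BraidGroup m →* (Module.End ℤ[X] (PermModule m))ˣ :=
  braidLift posUnit (fun _ _ h => Units.ext (posOp_comm h)) (fun _ _ h => Units.ext (posOp_braid h))

theorem braidRep_braidGen {m : ℕ} (i : Fin m) : braidRep m (braidGen i) = posUnit i :=
  braidLift_braidGen _ _ _ i

/-- The regular representation of the Hecke algebra. -/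
def heckeRep (m : ℕ) : HeckeAlgebra m →ₐ[ℤ[X]] Module.End ℤ[X] (PermModule m) :=
  RingQuot.liftAlgHom ℤ[X]
    ⟨MonoidAlgebra.lift ℤ[X] _ (BraidGroup m) ((Units.coeHom _).comp (braidRep m)), by
      rintro _ _ ⟨i⟩
      rw [map_sub, AlgHom.commutes, MonoidAlgebra.lift_of, MonoidAlgebra.lift_of,
        MonoidHom.comp_apply, MonoidHom.comp_apply, map_inv, braidRep_braidGen, Units.coeHom_apply,
        Units.coeHom_apply]
      exact sub_eq_of_eq_add' (posOp_eq i)⟩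

theorem heckeRep_toHecke {m : ℕ} (β : BraidGroup m) :
    heckeRep m (toHecke m β) = (braidRep m β : Module.End ℤ[X] (PermModule m)) := by
  refine (RingQuot.liftAlgHom_mkAlgHom_apply ℤ[X] _ _ _).trans ?_
  rw [MonoidAlgebra.lift_of]; rfl

theorem heckeRep_braidGen {m : ℕ} (i : Fin m) :
    heckeRep m (toHecke m (braidGen i)) = posOp i := by
  rw [heckeRep_toHecke, braidRep_braidGen]; rfl

theorem heckeRep_heckeGen {m : ℕ} (i : Fin m) : heckeRep m (heckeGen i) = negOp i := by
  rw [heckeGen, heckeRep_toHecke, map_inv, braidRep_braidGen]; rfl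

/-- The coordinates of an element of the Hecke algebra: its value at the vector of the identity. -/
def heckeCoord (m : ℕ) : HeckeAlgebra m →ₗ[ℤ[X]] PermModule m :=
  (LinearMap.applyₗ (permVec 1)).comp (heckeRep m).toLinearMap

theorem heckeCoord_apply {m : ℕ} (h : HeckeAlgebra m) :
    heckeCoord m h = heckeRep m h (permVec 1) := rfl

theorem heckeCoord_mul {m : ℕ} (h h' : HeckeAlgebra m) :
    heckeCoord m (h * h') = heckeRep m h (heckeCoord m h') := by
  rw [heckeCoord_apply, map_mul]; rfl

theorem heckeCoord_one (m : ℕ) : heckeCoord m 1 = permVec 1 := by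
  rw [heckeCoord_apply, map_one]; rfl

/-- At an ascent there is no correction term. This is the case in which a letter prolongs a reduced
word. -/
theorem negOp_permVec {m : ℕ} {i : Fin m} {v : Equiv.Perm (Fin (m + 1))}
    (h : v i.castSucc < v i.succ) : negOp i (permVec v) = permVec (v * adjSwap i) := by
  funext u
  have hu : u * adjSwap i = v ↔ u = v * adjSwap i := by
    rw [← adjSwap_inv i, mul_inv_eq_iff_eq_mul, adjSwap_inv]
  rw [negOp_apply]
  simp only [Pi.single_apply, hu]
  rw [sub_eq_self, ite_eq_right_iff]
  intro h'
  rw [if_neg, mul_zero]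
  rintro rfl
  exact h'.not_gt h

/-! ### Reduced words -/

theorem perm_apply_inv_apply {α : Type*} (w : Equiv.Perm α) (x : α) : w (w⁻¹ x) = x :=
  w.apply_symm_apply x

/-- The exchange property: a word whose permutation inverts `b < a` can be shortened by deleting
one letter. -/
theorem exists_shorter_word {m : ℕ} (l : List (Fin m)) {a b : Fin (m + 1)} (hba : b < a)
    (h : (l.map adjSwap).prod a < (l.map adjSwap).prod b) :
    ∃ l' : List (Fin m), (l'.map adjSwap).prod = (l.map adjSwap).prod * Equiv.swap a b ∧
      l'.length < l.length := by
  induction l with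
  | nil => exact absurd h (by simpa using hba.le)
  | cons j l ih =>
    rw [List.map_cons, List.prod_cons] at h ⊢
    generalize hw : (l.map adjSwap).prod = w at *
    rcases lt_or_gt_of_ne (w.injective.ne hba.ne) with hlt | hlt
    -- `s_j` can reverse the order of two values only if they are `j` and `j + 1`. The first letter
    -- is then the one to delete.
    · have key : w a = j.succ ∧ w b = j.castSucc := by
        rw [Equiv.Perm.mul_apply, Equiv.Perm.mul_apply] at h
        by_cases h1 : w a = j.succ <;> by_cases h2 : w b = j.castSucc
        · exact ⟨h1, h2⟩
        · exfalso
          rw [h1, adjSwap_succ, adjSwap_of_ne h2 (by rw [← h1]; exact hlt.ne)] at h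
          rw [h1] at hlt
          simp only [Fin.lt_def, Fin.val_castSucc, Fin.val_succ] at h hlt
          omega
        · exfalso
          rw [h2, adjSwap_castSucc, adjSwap_of_ne (by rw [← h2]; exact hlt.ne') h1] at h
          rw [h2] at hlt
          rw [Fin.ext_iff] at h1
          simp only [Fin.lt_def, Fin.val_castSucc, Fin.val_succ] at h hlt h1
          omega
        · exfalso
          by_cases h3 : w a = j.castSucc
          · rw [h3, adjSwap_castSucc] at h
            rw [adjSwap_of_ne h2 (by
              rw [h3] at hlt; exact (hlt.trans Fin.castSucc_lt_succ).ne)] at h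
            rw [h3] at hlt
            simp only [Fin.lt_def, Fin.val_castSucc, Fin.val_succ] at h hlt
            omega
          · rw [adjSwap_of_ne h3 h1] at h
            by_cases h4 : w b = j.succ
            · rw [h4, adjSwap_succ] at h
              rw [h4] at hlt
              simp only [Fin.lt_def, Fin.val_castSucc, Fin.val_succ] at h hlt
              omega
            · rw [adjSwap_of_ne h2 h4] at h
              exact h.not_gt hlt
      refine ⟨l, ?_, by simp⟩
      have : adjSwap j = Equiv.swap (w a) (w b) := by
        rw [key.1, key.2, Equiv.swap_comm]; rfl
      rw [this, ← Equiv.mul_swap_eq_swap_mul, mul_assoc, Equiv.swap_mul_self, mul_one, hw]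
    · obtain ⟨l', hl', hlen⟩ := ih hlt
      exact ⟨j :: l', by rw [List.map_cons, List.prod_cons, hl', mul_assoc],
        by simpa using hlen⟩

theorem IsReducedWord.tail {m : ℕ} {i : Fin m} {l : List (Fin m)} {π : Equiv.Perm (Fin (m + 1))}
    (h : IsReducedWord (i :: l) π) : IsReducedWord l (l.map adjSwap).prod := by
  refine ⟨rfl, fun l' hl' => ?_⟩
  have := h.2 (i :: l') (by rw [← h.1, List.map_cons, List.map_cons, List.prod_cons,
    List.prod_cons, hl'])
  simpa using this

/-- Otherwise the exchange property, applied to the tail, would give a word for `s_i` times the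
tail, that is for `π`, with fewer letters than the tail itself. -/
theorem IsReducedWord.head_lt {m : ℕ} {i : Fin m} {l : List (Fin m)}
    {π : Equiv.Perm (Fin (m + 1))} (h : IsReducedWord (i :: l) π) :
    (l.map adjSwap).prod⁻¹ i.castSucc < (l.map adjSwap).prod⁻¹ i.succ := by
  by_contra hlt
  rw [← Equiv.Perm.lt_castSucc_iff_not] at hlt
  obtain ⟨l', hl', hlen⟩ := exists_shorter_word l hlt (by
    rw [perm_apply_inv_apply, perm_apply_inv_apply]; exact Fin.castSucc_lt_succ)
  have h2 := h.2 l' (by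
    rw [hl', ← h.1, List.map_cons, List.prod_cons, Equiv.mul_swap_eq_swap_mul,
      perm_apply_inv_apply, perm_apply_inv_apply]; rfl)
  rw [List.length_cons] at h2
  omega

/-- Any reduced word of `π` gives the basis vector of `π⁻¹`. -/
theorem IsReducedWord.heckeCoord_eq {m : ℕ} {l : List (Fin m)} {π : Equiv.Perm (Fin (m + 1))}
    (h : IsReducedWord l π) :
    heckeCoord m (toHecke m (l.map fun i => (braidGen i)⁻¹).prod) = permVec π⁻¹ := by
  induction l generalizing π with
  | nil => obtain rfl : 1 = π := h.1; rw [List.map_nil, List.prod_nil, map_one, heckeCoord_one,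
      inv_one]
  | cons i l ih =>
    rw [List.map_cons, List.prod_cons, map_mul, heckeCoord_mul, ih h.tail]
    change heckeRep m (heckeGen i) _ = _
    rw [heckeRep_heckeGen, negOp_permVec h.head_lt, ← h.1, List.map_cons, List.prod_cons,
      mul_inv_rev, adjSwap_inv]

theorem heckeCoord_negPermBraid {m : ℕ} (π : Equiv.Perm (Fin (m + 1))) :
    heckeCoord m (toHecke m (negPermBraid π)) = permVec π⁻¹ :=
  (exists_isReducedWord π).choose_spec.heckeCoord_eq

theorem heckeCoord_surjective (m : ℕ) : Function.Surjective (heckeCoord m) := by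
  intro f
  refine ⟨∑ v, f v • toHecke m (negPermBraid v⁻¹), ?_⟩
  simp only [map_sum, map_smul, heckeCoord_negPermBraid, inv_inv]
  funext u
  simp [Finset.sum_apply, Pi.single_apply]

/-! ### The basis of negative permutation braids -/

/-- The elements `σ_n⁻¹ σ_{n-1}⁻¹ ⋯ σ_k⁻¹` of `H_{n+1}(z)`, a basis over `H_n(z)`. -/
def heckeCoset : ∀ m : ℕ, Fin (m + 1) → HeckeAlgebra m
  | 0 => fun _ => 1
  | m + 1 => Fin.snoc (α := fun _ => HeckeAlgebra (m + 1))
      (fun k => heckeLast m * heckeIncl m (heckeCoset m k)) 1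

theorem heckeCoset_last (m : ℕ) : heckeCoset (m + 1) (Fin.last (m + 1)) = 1 :=
  Fin.snoc_last (α := fun _ => HeckeAlgebra (m + 1)) _ _

theorem heckeCoset_castSucc (m : ℕ) (k : Fin (m + 1)) :
    heckeCoset (m + 1) k.castSucc = heckeLast m * heckeIncl m (heckeCoset m k) :=
  Fin.snoc_castSucc (α := fun _ => HeckeAlgebra (m + 1)) _ _ _

/-- The map `(a_k) ↦ ∑ a_k σ_n⁻¹ ⋯ σ_k⁻¹`. -/
def heckeCosetSum (m : ℕ) : (Fin (m + 2) → HeckeAlgebra m) →ₗ[ℤ[X]] HeckeAlgebra (m + 1) where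
  toFun a := ∑ k, heckeIncl m (a k) * heckeCoset (m + 1) k
  map_add' a b := by
    simp only [Pi.add_apply, map_add, add_mul, Finset.sum_add_distrib]
  map_smul' r a := by
    simp only [Pi.smul_apply, map_smul, smul_mul_assoc, Finset.smul_sum, RingHom.id_apply]

theorem heckeCosetSum_apply {m : ℕ} (a : Fin (m + 2) → HeckeAlgebra m) :
    heckeCosetSum m a = ∑ k : Fin (m + 1),
      heckeIncl m (a k.castSucc) * (heckeLast m * heckeIncl m (heckeCoset m k)) +
        heckeIncl m (a (Fin.last (m + 1))) := by
  change ∑ k, heckeIncl m (a k) * heckeCoset (m + 1) k = _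
  rw [Fin.sum_univ_castSucc, heckeCoset_last, mul_one]
  simp only [heckeCoset_castSucc]

theorem heckeCosetSum_snoc {m : ℕ} (a : Fin (m + 1) → HeckeAlgebra m) (x : HeckeAlgebra m) :
    heckeCosetSum m (Fin.snoc (α := fun _ => HeckeAlgebra m) a x) = ∑ k : Fin (m + 1),
      heckeIncl m (a k) * (heckeLast m * heckeIncl m (heckeCoset m k)) + heckeIncl m x := by
  rw [heckeCosetSum_apply]
  simp only [Fin.snoc_last, Fin.snoc_castSucc]

/-- The coefficients `a_k` come from `H_{n-1}(z)` (or are scalars), and this is why `σ_n⁻¹` can be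
moved past them. Surjectivity is a hypothesis for smaller indices only, so that the lemma can serve
in the induction that proves it. -/
theorem exists_sum_mul_heckeCoset {m : ℕ}
    (H : ∀ k < m, Function.Surjective (heckeCosetSum k)) (y : HeckeAlgebra m) :
    ∃ a : Fin (m + 1) → HeckeAlgebra m, y = ∑ k, a k * heckeCoset m k ∧
      ∀ k, heckeLast m * heckeIncl m (a k) = heckeIncl m (a k) * heckeLast m := by
  cases m with
  | zero =>
    obtain ⟨r, rfl⟩ := y.exists_eq_algebraMap
    refine ⟨fun _ => algebraMap _ _ r, ?_, fun _ => ?_⟩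
    · simp [heckeCoset]
    · rw [AlgHom.commutes, Algebra.commutes]
  | succ m =>
    obtain ⟨a, rfl⟩ := H m (Nat.lt_succ_self m) y
    exact ⟨fun k => heckeIncl m (a k), rfl, fun k => heckeLast_commute _⟩

/-- With `y = ∑ a_k c_k` as in `exists_sum_mul_heckeCoset`, one has `x σ_n⁻¹ y = ∑ (x a_k) σ_n⁻¹
c_k`. -/
theorem heckeCosetSum_surjective (m : ℕ) : Function.Surjective (heckeCosetSum m) := by
  induction m using Nat.strong_induction_on with
  | _ m ih =>
  intro h
  induction h using HeckeAlgebra.succ_induction with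
  | incl x =>
    refine ⟨Fin.snoc (α := fun _ => HeckeAlgebra m) 0 x, ?_⟩
    rw [heckeCosetSum_snoc]
    simp
  | mid x y =>
    obtain ⟨a, rfl, ha⟩ := exists_sum_mul_heckeCoset ih y
    refine ⟨Fin.snoc (α := fun _ => HeckeAlgebra m) (fun k => x * a k) 0, ?_⟩
    rw [heckeCosetSum_snoc, map_zero, add_zero, map_sum, Finset.mul_sum]
    refine Finset.sum_congr rfl fun k _ => ?_
    rw [map_mul, map_mul, mul_assoc, mul_assoc, ← mul_assoc (heckeLast m) (heckeIncl m (a k)), ha,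
      mul_assoc]
  | add x y hx hy =>
    obtain ⟨a, rfl⟩ := hx
    obtain ⟨b, rfl⟩ := hy
    exact ⟨a + b, map_add _ _ _⟩

/-- The map is onto, and both sides are free: the source consists of `m + 2` copies of a module of
rank `(m+1)!`, and the target has rank `(m+2)!`. -/
theorem heckeCoord_comp_heckeCosetSum_bijective {m : ℕ}
    (hm : Function.Bijective (heckeCoord m)) :
    Function.Bijective ((heckeCoord (m + 1)).comp (heckeCosetSum m)) := by
  let e : (Fin (m + 2) → PermModule m) ≃ₗ[ℤ[X]] (Fin (m + 2) → HeckeAlgebra m) :=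
    LinearEquiv.piCongrRight fun _ => (LinearEquiv.ofBijective (heckeCoord m) hm).symm
  have hsurj : Function.Surjective ((heckeCoord (m + 1)).comp (heckeCosetSum m)) := by
    rw [LinearMap.coe_comp]
    exact (heckeCoord_surjective _).comp (heckeCosetSum_surjective m)
  have h : Function.Bijective (((heckeCoord (m + 1)).comp (heckeCosetSum m)).comp
      e.toLinearMap) := by
    refine OrzechProperty.bijective_of_surjective_of_finrank_le _ ?_ ?_
    · rw [LinearMap.coe_comp]
      exact hsurj.comp e.surjective
    · rw [Module.finrank_pi_fintype]
      simp [Fintype.card_perm, Nat.factorial_succ (m + 1)]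
  rw [LinearMap.coe_comp] at h
  exact (Function.Bijective.of_comp_iff _ e.bijective).mp h

/-- In the inductive step, injectivity passes from the composite to its second factor because the
first factor is onto. -/
theorem heckeCoord_bijective (m : ℕ) : Function.Bijective (heckeCoord m) := by
  induction m with
  | zero =>
    refine ⟨fun x y hxy => ?_, heckeCoord_surjective 0⟩
    obtain ⟨r, rfl⟩ := x.exists_eq_algebraMap
    obtain ⟨s, rfl⟩ := y.exists_eq_algebraMap
    rw [Algebra.algebraMap_eq_smul_one, Algebra.algebraMap_eq_smul_one, map_smul, map_smul,
      heckeCoord_one] at hxy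
    have := congrFun hxy 1
    simp only [Pi.smul_apply, Pi.single_eq_same, smul_eq_mul, mul_one] at this
    rw [this]
  | succ m ih =>
    have h := heckeCoord_comp_heckeCosetSum_bijective ih
    rw [LinearMap.coe_comp] at h
    exact ⟨h.injective.of_comp_right (heckeCosetSum_surjective m), heckeCoord_surjective _⟩

theorem heckeCosetSum_bijective (m : ℕ) : Function.Bijective (heckeCosetSum m) := by
  have h := (heckeCoord_comp_heckeCosetSum_bijective (heckeCoord_bijective m)).injective
  rw [LinearMap.coe_comp] at h
  exact ⟨h.of_comp, heckeCosetSum_surjective m⟩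

/-- The coordinates with respect to the negative permutation braids. -/
def heckeEquiv (m : ℕ) : HeckeAlgebra m ≃ₗ[ℤ[X]] (Equiv.Perm (Fin (m + 1)) → ℤ[X]) :=
  (LinearEquiv.ofBijective (heckeCoord m) (heckeCoord_bijective m)).trans
    (LinearEquiv.funCongrLeft ℤ[X] ℤ[X] (Equiv.inv _))

theorem heckeEquiv_apply {m : ℕ} (h : HeckeAlgebra m) (π : Equiv.Perm (Fin (m + 1))) :
    heckeEquiv m h π = heckeCoord m h π⁻¹ := rfl

theorem heckeEquiv_negPermBraid {m : ℕ} (π : Equiv.Perm (Fin (m + 1))) :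
    heckeEquiv m (toHecke m (negPermBraid π)) = Pi.single π 1 := by
  funext u
  rw [heckeEquiv_apply, heckeCoord_negPermBraid]
  simp only [Pi.single_apply, inv_inj]

/-- The basis of the Hecke algebra that consists of the negative permutation braids. -/
def negPermBasis (m : ℕ) : Module.Basis (Equiv.Perm (Fin (m + 1))) ℤ[X] (HeckeAlgebra m) :=
  Module.Basis.ofEquivFun (heckeEquiv m)

theorem negPermBasis_apply {m : ℕ} (π : Equiv.Perm (Fin (m + 1))) :
    negPermBasis m π = toHecke m (negPermBraid π) := by
  rw [negPermBasis, Module.Basis.coe_ofEquivFun, LinearEquiv.symm_apply_eq,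
    heckeEquiv_negPermBraid]

theorem sum_heckeCoord_smul {m : ℕ} (h : HeckeAlgebra m) :
    h = ∑ π, heckeCoord m h π⁻¹ • toHecke m (negPermBraid π) := by
  conv_lhs => rw [← (negPermBasis m).sum_repr h]
  refine Finset.sum_congr rfl fun π _ => ?_
  rw [negPermBasis_apply]; rfl

/-! ### Ocneanu's trace -/

/-- The extension of Ocneanu's trace from `H_n(z)` to `H_{n+1}(z)`. -/
def traceSucc {m : ℕ} (tr : HeckeAlgebra m →ₗ[ℤ[X]] ℤ[X][X]) :
    HeckeAlgebra (m + 1) →ₗ[ℤ[X]] ℤ[X][X] :=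
  (tr.comp (LinearMap.proj (Fin.last (m + 1))) +
    LinearMap.comp (LinearMap.mulLeft ℤ[X] (Polynomial.X + Polynomial.C (-Polynomial.X)))
      (∑ k : Fin (m + 1), (tr.comp (LinearMap.mulRight ℤ[X] (heckeCoset m k))).comp
        (LinearMap.proj k.castSucc))).comp
    (LinearEquiv.ofBijective (heckeCosetSum m) (heckeCosetSum_bijective m)).symm.toLinearMap

/-- The factor `T - z` is what a trace must assign to `σ_n⁻¹ = σ_n - z`. -/
theorem traceSucc_heckeCosetSum {m : ℕ} (tr : HeckeAlgebra m →ₗ[ℤ[X]] ℤ[X][X])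
    (a : Fin (m + 1) → HeckeAlgebra m) (x : HeckeAlgebra m) :
    traceSucc tr (∑ k : Fin (m + 1),
      heckeIncl m (a k) * (heckeLast m * heckeIncl m (heckeCoset m k)) + heckeIncl m x) =
    tr x + (Polynomial.X + Polynomial.C (-Polynomial.X)) * ∑ k, tr (a k * heckeCoset m k) := by
  rw [← heckeCosetSum_snoc, traceSucc, LinearMap.comp_apply, LinearEquiv.coe_coe,
    LinearEquiv.ofBijective_symm_apply_apply]
  simp [Finset.mul_sum]

theorem traceSucc_incl {m : ℕ} (tr : HeckeAlgebra m →ₗ[ℤ[X]] ℤ[X][X]) (x : HeckeAlgebra m) :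
    traceSucc tr (heckeIncl m x) = tr x := by
  have := traceSucc_heckeCosetSum tr 0 x
  simpa using this

/-- The definition covers only the right factors `heckeCoset m k`. A general `y` reduces to them
because its coefficients commute with `σ_n⁻¹`. -/
theorem traceSucc_mid {m : ℕ} (tr : HeckeAlgebra m →ₗ[ℤ[X]] ℤ[X][X]) (x y : HeckeAlgebra m) :
    traceSucc tr (heckeIncl m x * heckeLast m * heckeIncl m y) =
      (Polynomial.X + Polynomial.C (-Polynomial.X)) * tr (x * y) := by
  obtain ⟨a, rfl, ha⟩ := exists_sum_mul_heckeCoset (fun k _ => heckeCosetSum_surjective k) y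
  have := traceSucc_heckeCosetSum tr (fun k => x * a k) 0
  rw [map_zero, map_zero, add_zero, zero_add] at this
  rw [Finset.mul_sum, map_sum, map_sum, Finset.mul_sum]
  simp only [← mul_assoc x]
  rw [← this]
  congr 1
  refine Finset.sum_congr rfl fun k _ => ?_
  rw [map_mul, map_mul, mul_assoc, mul_assoc, ← mul_assoc (heckeLast m) (heckeIncl m (a k)), ha,
    mul_assoc]

/-- A functional that is symmetric with respect to the generators is a trace. -/
theorem trace_mul_comm_of_gen {m : ℕ} (tr : HeckeAlgebra m →ₗ[ℤ[X]] ℤ[X][X])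
    (H : ∀ i x, tr (x * heckeGen i) = tr (heckeGen i * x)) (x y : HeckeAlgebra m) :
    tr (x * y) = tr (y * x) := by
  induction y using HeckeAlgebra.induction generalizing x with
  | algebraMap r => rw [Algebra.commutes]
  | gen i => exact H i x
  | add y y' hy hy' => rw [mul_add, add_mul, map_add, map_add, hy, hy']
  | mul y y' hy hy' => rw [← mul_assoc, hy', ← mul_assoc, hy, mul_assoc]

/-- Against a generator of `H_n(z)`, or for an element of `H_n(z)`, symmetry is inherited from `tr`
through `traceSucc_incl` and `traceSucc_mid`. What remains is `σ_n⁻¹` against `x σ_n⁻¹ y`, which is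
the hypothesis `H`. -/
theorem traceSucc_mul_comm {m : ℕ} (tr : HeckeAlgebra m →ₗ[ℤ[X]] ℤ[X][X])
    (htr : ∀ x y, tr (x * y) = tr (y * x))
    (H : ∀ x y, traceSucc tr (heckeIncl m x * (heckeLast m * heckeIncl m y * heckeLast m)) =
      traceSucc tr (heckeLast m * heckeIncl m x * heckeLast m * heckeIncl m y))
    (x y : HeckeAlgebra (m + 1)) : traceSucc tr (x * y) = traceSucc tr (y * x) := by
  refine trace_mul_comm_of_gen _ (fun i x => ?_) x y
  induction x using HeckeAlgebra.succ_induction with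
  | incl x =>
    induction i using Fin.lastCases with
    | last =>
      have h1 := traceSucc_mid tr x 1
      have h2 := traceSucc_mid tr 1 x
      rw [map_one, mul_one, mul_one] at h1
      rw [map_one, one_mul, one_mul] at h2
      rw [h1, h2]
    | cast i => rw [← heckeIncl_heckeGen, ← map_mul, ← map_mul, traceSucc_incl, traceSucc_incl, htr]
  | mid x y =>
    induction i using Fin.lastCases with
    | last =>
      have := H x y
      simpa only [mul_assoc] using this
    | cast i =>
      rw [← heckeIncl_heckeGen, mul_assoc, ← map_mul, ← mul_assoc, ← mul_assoc, ← map_mul,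
        traceSucc_mid, traceSucc_mid, ← mul_assoc, htr, ← mul_assoc]
  | add x y hx hy => rw [add_mul, mul_add, map_add, map_add, hx, hy]

theorem traceSucc_zero_mul_comm (tr : HeckeAlgebra 0 →ₗ[ℤ[X]] ℤ[X][X])
    (x y : HeckeAlgebra 1) : traceSucc tr (x * y) = traceSucc tr (y * x) := by
  refine traceSucc_mul_comm tr (fun x y => ?_) (fun x y => ?_) x y
  · obtain ⟨r, rfl⟩ := x.exists_eq_algebraMap
    rw [Algebra.commutes]
  · obtain ⟨r, rfl⟩ := x.exists_eq_algebraMap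
    obtain ⟨s, rfl⟩ := y.exists_eq_algebraMap
    simp only [Algebra.algebraMap_eq_smul_one, map_smul, map_one, smul_mul_assoc, mul_smul_comm,
      one_mul, mul_one, smul_smul]

/-- One of four evaluations of the two sides of `H` in `traceSucc_mul_comm`. The factor between the
two letters `σ_n⁻¹` comes either from `H_{n-1}(z)` (quadratic relation) or from `H_{n-1}(z)
σ_{n-1}⁻¹ H_{n-1}(z)` (braid relation). -/
theorem traceSucc_mul_heckeLast_incl {m : ℕ} (tr : HeckeAlgebra (m + 1) →ₗ[ℤ[X]] ℤ[X][X])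
    (x : HeckeAlgebra (m + 1)) (y : HeckeAlgebra m) :
    traceSucc tr (heckeIncl _ x *
      (heckeLast (m + 1) * heckeIncl _ (heckeIncl m y) * heckeLast (m + 1))) =
    tr (x * heckeIncl m y) + (-Polynomial.X : ℤ[X]) •
      ((Polynomial.X + Polynomial.C (-Polynomial.X)) * tr (x * heckeIncl m y)) := by
  have h := traceSucc_mid tr (x * heckeIncl m y) 1
  rw [map_one, mul_one, mul_one] at h
  rw [heckeLast_mul_incl_mul_heckeLast, mul_add, map_add, ← map_mul, traceSucc_incl,
    mul_smul_comm, map_smul, ← mul_assoc, ← map_mul, h]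

theorem traceSucc_heckeLast_incl_mul {m : ℕ} (tr : HeckeAlgebra (m + 1) →ₗ[ℤ[X]] ℤ[X][X])
    (x : HeckeAlgebra m) (y : HeckeAlgebra (m + 1)) :
    traceSucc tr (heckeLast (m + 1) * heckeIncl _ (heckeIncl m x) * heckeLast (m + 1) *
      heckeIncl _ y) =
    tr (heckeIncl m x * y) + (-Polynomial.X : ℤ[X]) •
      ((Polynomial.X + Polynomial.C (-Polynomial.X)) * tr (heckeIncl m x * y)) := by
  rw [heckeLast_mul_incl_mul_heckeLast, add_mul, map_add, ← map_mul, traceSucc_incl,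
    smul_mul_assoc, map_smul, traceSucc_mid]

theorem heckeGen_mul_heckeGen_sandwich {m : ℕ} (i : Fin m) (x y : HeckeAlgebra m) :
    x * heckeGen i * (heckeGen i * y) = x * y + (-Polynomial.X : ℤ[X]) • (x * heckeGen i * y) := by
  rw [mul_assoc x, ← mul_assoc (heckeGen i), heckeGen_mul_self, add_mul, one_mul, mul_add,
    smul_mul_assoc, mul_smul_comm, mul_assoc]

theorem traceSucc_mul_heckeLast_mid {m : ℕ} (tr : HeckeAlgebra (m + 1) →ₗ[ℤ[X]] ℤ[X][X])
    (x : HeckeAlgebra (m + 1)) (y y' : HeckeAlgebra m) :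
    traceSucc tr (heckeIncl _ x * (heckeLast (m + 1) *
      heckeIncl _ (heckeIncl m y * heckeLast m * heckeIncl m y') * heckeLast (m + 1))) =
    (Polynomial.X + Polynomial.C (-Polynomial.X)) * (tr (x * (heckeIncl m (y * y'))) +
      (-Polynomial.X : ℤ[X]) • tr (x * (heckeIncl m y * heckeLast m * heckeIncl m y'))) := by
  rw [heckeLast_mul_mul_heckeLast, ← mul_assoc, ← mul_assoc, ← map_mul, traceSucc_mid, mul_assoc,
    heckeGen_mul_heckeGen_sandwich, mul_add, map_add, mul_smul_comm, map_smul,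
    map_mul (heckeIncl m)]

theorem traceSucc_heckeLast_mid_mul {m : ℕ} (tr : HeckeAlgebra (m + 1) →ₗ[ℤ[X]] ℤ[X][X])
    (x x' : HeckeAlgebra m) (y : HeckeAlgebra (m + 1)) :
    traceSucc tr (heckeLast (m + 1) *
      heckeIncl _ (heckeIncl m x * heckeLast m * heckeIncl m x') * heckeLast (m + 1) *
        heckeIncl _ y) =
    (Polynomial.X + Polynomial.C (-Polynomial.X)) * (tr (heckeIncl m (x * x') * y) +
      (-Polynomial.X : ℤ[X]) • tr (heckeIncl m x * heckeLast m * heckeIncl m x' * y)) := by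
  rw [heckeLast_mul_mul_heckeLast, mul_assoc, ← map_mul, traceSucc_mid, ← mul_assoc,
    heckeGen_mul_heckeGen_sandwich, add_mul (_ * _), map_add, smul_mul_assoc, map_smul,
    map_mul (heckeIncl m)]

/-- Both `x` and `y` are decomposed one level further down. The four resulting identities hold by
`traceSucc_incl` and `traceSucc_mid` at the lower level, so the functional there must itself be of
the form `traceSucc tr`. -/
theorem traceSucc_succ_mul_comm {m : ℕ} (tr : HeckeAlgebra m →ₗ[ℤ[X]] ℤ[X][X])
    (htr : ∀ x y, traceSucc tr (x * y) = traceSucc tr (y * x)) (x y : HeckeAlgebra (m + 2)) :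
    traceSucc (traceSucc tr) (x * y) = traceSucc (traceSucc tr) (y * x) := by
  refine traceSucc_mul_comm _ htr (fun x y => ?_) x y
  induction x using HeckeAlgebra.succ_induction with
  | add x x' hx hx' =>
    rw [map_add, add_mul, mul_add, add_mul, add_mul, map_add, map_add, hx, hx']
  | incl x =>
    induction y using HeckeAlgebra.succ_induction with
    | add y y' hy hy' =>
      rw [map_add, mul_add, mul_add, add_mul, mul_add, map_add, map_add, hy, hy']
    | incl y => rw [traceSucc_mul_heckeLast_incl, traceSucc_heckeLast_incl_mul]
    | mid y y' =>
      rw [traceSucc_mul_heckeLast_mid, traceSucc_heckeLast_incl_mul, ← mul_assoc, ← mul_assoc,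
        ← map_mul, ← map_mul, traceSucc_incl, traceSucc_mid, mul_add, mul_smul_comm, mul_assoc]
  | mid x x' =>
    induction y using HeckeAlgebra.succ_induction with
    | add y y' hy hy' =>
      rw [map_add, mul_add, mul_add, add_mul, mul_add, map_add, map_add, hy, hy']
    | incl y =>
      rw [traceSucc_mul_heckeLast_incl, traceSucc_heckeLast_mid_mul, mul_assoc _ _ (heckeIncl m y),
        ← map_mul, ← map_mul, traceSucc_incl, traceSucc_mid, mul_add, mul_smul_comm, mul_assoc]
    | mid y y' =>
      rw [traceSucc_mul_heckeLast_mid, traceSucc_heckeLast_mid_mul, mul_assoc _ _ (heckeIncl m _),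
        ← map_mul, traceSucc_mid, ← mul_assoc (heckeIncl m (x * x')),
        ← mul_assoc (heckeIncl m (x * x')), ← map_mul, traceSucc_mid]
      simp only [mul_assoc]

/-- Ocneanu's trace, defined by recursion. -/
def traceRec : ∀ m : ℕ, HeckeAlgebra m →ₗ[ℤ[X]] ℤ[X][X]
  | 0 => (Algebra.linearMap ℤ[X] ℤ[X][X]).comp ((LinearMap.proj 1).comp (heckeCoord 0))
  | m + 1 => traceSucc (traceRec m)

theorem traceRec_mul_comm (m : ℕ) : ∀ x y, traceRec m (x * y) = traceRec m (y * x) := by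
  -- The inductive step needs two successive extensions, so the case of two strands has to be
  -- treated separately.
  induction m using Nat.twoStepInduction with
  | zero =>
    intro x y
    obtain ⟨r, rfl⟩ := x.exists_eq_algebraMap
    rw [Algebra.commutes]
  | one => exact traceSucc_zero_mul_comm _
  | more m _ h => exact traceSucc_succ_mul_comm _ h

theorem heckeGen_add_smul_one {m : ℕ} (i : Fin m) :
    toHecke m (braidGen i) = heckeGen i + (Polynomial.X : ℤ[X]) • 1 := by
  rw [toHecke_braidGen, Algebra.algebraMap_eq_smul_one]

theorem isOcneanuTrace_traceRec : IsOcneanuTrace traceRec where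
  map_one m := by
    induction m with
    | zero => simp [traceRec, heckeCoord_one]
    | succ m ih => rw [traceRec, ← map_one (heckeIncl m), traceSucc_incl, ih]
  mul_comm := traceRec_mul_comm
  incl m x := traceSucc_incl _ x
  markov m x := by
    have h := traceSucc_mid (traceRec m) x 1
    rw [map_one, mul_one, mul_one] at h
    rw [heckeGen_add_smul_one, mul_add, map_add, mul_smul_comm, mul_one, map_smul, traceRec, h,
      traceSucc_incl, Polynomial.smul_eq_C_mul, map_neg]
    ring

/-- Cyclicity carries `y` to the front, and the Markov property applies with `σ_n⁻¹ = σ_n - z`. -/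
theorem IsOcneanuTrace.mid {tr : ∀ m : ℕ, HeckeAlgebra m →ₗ[ℤ[X]] ℤ[X][X]}
    (h : IsOcneanuTrace tr) {m : ℕ} (x y : HeckeAlgebra m) :
    tr (m + 1) (heckeIncl m x * heckeLast m * heckeIncl m y) =
      (Polynomial.X - Polynomial.C Polynomial.X) * tr m (x * y) := by
  have h1 := h.markov m (y * x)
  rw [heckeGen_add_smul_one, mul_add, map_add, mul_smul_comm, mul_one, map_smul, h.incl,
    Polynomial.smul_eq_C_mul, map_mul (heckeIncl m), h.mul_comm m y x] at h1
  rw [h.mul_comm, ← mul_assoc, sub_mul]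
  exact eq_sub_of_add_eq h1

theorem IsOcneanuTrace.unique {tr tr' : ∀ m : ℕ, HeckeAlgebra m →ₗ[ℤ[X]] ℤ[X][X]}
    (h : IsOcneanuTrace tr) (h' : IsOcneanuTrace tr') : tr = tr' := by
  funext m
  refine LinearMap.ext ?_
  induction m with
  | zero =>
    intro x
    obtain ⟨r, rfl⟩ := x.exists_eq_algebraMap
    rw [Algebra.algebraMap_eq_smul_one, map_smul, map_smul, h.map_one, h'.map_one]
  | succ m ih =>
    intro x
    induction x using HeckeAlgebra.succ_induction with
    | incl x => rw [h.incl, h'.incl, ih]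
    | mid x y => rw [h.mid, h'.mid, ih]
    | add x y hx hy => rw [map_add, map_add, hx, hy]

theorem isOcneanuTrace_ocneanuTrace : IsOcneanuTrace ocneanuTrace :=
  Classical.epsilon_spec ⟨_, isOcneanuTrace_traceRec⟩

/-! ### The left column in terms of the regular representation -/

/-- The permutation of one more letter that fixes the last letter. -/
def permLift {m : ℕ} (u : Equiv.Perm (Fin (m + 1))) : Equiv.Perm (Fin (m + 2)) where
  toFun := Fin.lastCases (Fin.last _) fun k => (u k).castSucc
  invFun := Fin.lastCases (Fin.last _) fun k => (u.symm k).castSucc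
  left_inv k := by induction k using Fin.lastCases <;> simp
  right_inv k := by induction k using Fin.lastCases <;> simp

@[simp] theorem permLift_last {m : ℕ} (u : Equiv.Perm (Fin (m + 1))) :
    permLift u (Fin.last _) = Fin.last _ :=
  Fin.lastCases_last (motive := fun _ => Fin (m + 2))

@[simp] theorem permLift_castSucc {m : ℕ} (u : Equiv.Perm (Fin (m + 1))) (k : Fin (m + 1)) :
    permLift u k.castSucc = (u k).castSucc :=
  Fin.lastCases_castSucc (motive := fun _ => Fin (m + 2)) k

theorem permLift_one (m : ℕ) : permLift (1 : Equiv.Perm (Fin (m + 1))) = 1 := by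
  ext k
  induction k using Fin.lastCases <;> simp

theorem permLift_injective (m : ℕ) :
    Function.Injective (permLift : Equiv.Perm (Fin (m + 1)) → _) := by
  intro u u' h
  ext k
  have := congrArg (fun w : Equiv.Perm (Fin (m + 2)) => (w k.castSucc : ℕ)) h
  simpa using this

theorem permLift_mul_adjSwap {m : ℕ} (u : Equiv.Perm (Fin (m + 1))) (i : Fin m) :
    permLift (u * adjSwap i) = permLift u * adjSwap i.castSucc := by
  ext k
  rw [Equiv.Perm.mul_apply]
  induction k using Fin.lastCases with
  | last =>
    rw [adjSwap_of_ne (by simp [Fin.ext_iff]; omega) (by simp [Fin.ext_iff]; omega)]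
    simp
  | cast k =>
    rw [permLift_castSucc, Equiv.Perm.mul_apply]
    by_cases h : k = i.castSucc
    · rw [h, adjSwap_castSucc, adjSwap_castSucc, Fin.succ_castSucc, permLift_castSucc]
    · by_cases h' : k = i.succ
      · rw [h', adjSwap_succ, ← Fin.succ_castSucc, adjSwap_succ, permLift_castSucc]
      · rw [adjSwap_of_ne h h', adjSwap_of_ne, permLift_castSucc]
        · simpa using h
        · rw [Fin.succ_castSucc]; exact fun e => h' (Fin.castSucc_injective _ e)

/-- Restriction of functions to the permutations that fix the last letter. -/
def permRestrict (m : ℕ) : PermModule (m + 1) →ₗ[ℤ[X]] PermModule m :=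
  LinearMap.funLeft ℤ[X] ℤ[X] permLift

theorem permRestrict_apply {m : ℕ} (f : PermModule (m + 1)) (u : Equiv.Perm (Fin (m + 1))) :
    permRestrict m f u = f (permLift u) := rfl

theorem permRestrict_permVec_one (m : ℕ) : permRestrict m (permVec 1) = permVec 1 := by
  funext u
  rw [permRestrict_apply]
  simp only [Pi.single_apply, ← permLift_one, (permLift_injective m).eq_iff]

theorem permRestrict_negOp {m : ℕ} (i : Fin m) (f : PermModule (m + 1)) :
    permRestrict m (negOp i.castSucc f) = negOp i (permRestrict m f) := by
  funext u
  simp only [permRestrict_apply, negOp_apply, permLift_mul_adjSwap, permLift_castSucc,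
    Fin.succ_castSucc, Fin.castSucc_lt_castSucc_iff]

/-- The generators from `H_n(z)` multiply permutations by transpositions that fix the last letter,
and they compare only values at earlier letters. -/
theorem permRestrict_heckeRep {m : ℕ} (x : HeckeAlgebra m) (f : PermModule (m + 1)) :
    permRestrict m (heckeRep (m + 1) (heckeIncl m x) f) = heckeRep m x (permRestrict m f) := by
  induction x using HeckeAlgebra.induction generalizing f with
  | algebraMap r => simp only [AlgHom.commutes, Module.algebraMap_end_apply, map_smul]
  | gen i => rw [heckeIncl_heckeGen, heckeRep_heckeGen, heckeRep_heckeGen, permRestrict_negOp]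
  | add x y hx hy => simp only [map_add, LinearMap.add_apply, hx, hy]
  | mul x y hx hy => simp only [map_mul, Module.End.mul_apply, hx, hy]

theorem heckeRep_incl_eq_zero {m : ℕ} (x : HeckeAlgebra m) {f : PermModule (m + 1)}
    (hf : ∀ w, w (Fin.last _) ≠ Fin.last _ → f w = 0) (w : Equiv.Perm (Fin (m + 2)))
    (hw : w (Fin.last _) ≠ Fin.last _) : heckeRep (m + 1) (heckeIncl m x) f w = 0 := by
  induction x using HeckeAlgebra.induction generalizing f w with
  | algebraMap r =>
    rw [AlgHom.commutes, AlgHom.commutes, Module.algebraMap_end_apply, Pi.smul_apply, hf w hw,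
      smul_zero]
  | gen i =>
    rw [heckeIncl_heckeGen, heckeRep_heckeGen, negOp_apply, hf w hw, hf]
    · simp
    · rwa [Equiv.Perm.mul_apply,
        adjSwap_of_ne (by simp [Fin.ext_iff]; omega) (by simp [Fin.ext_iff]; omega)]
  | add x y hx hy =>
    rw [map_add, map_add, LinearMap.add_apply, Pi.add_apply, hx hf w hw, hy hf w hw, add_zero]
  | mul x y hx hy =>
    rw [map_mul, map_mul, Module.End.mul_apply]
    exact hx (fun w hw => hy hf w hw) w hw

/-- If `w` fixes the last letter, then `w s_n` does not, so the main term vanishes. Moreover `w`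
takes its maximum at the last letter, so there is no descent and no correction term. -/
theorem permRestrict_negOp_last {m : ℕ} {f : PermModule (m + 1)}
    (hf : ∀ w, w (Fin.last _) ≠ Fin.last _ → f w = 0) :
    permRestrict m (negOp (Fin.last m) f) = 0 := by
  funext u
  rw [permRestrict_apply, negOp_apply, hf, if_neg, sub_zero, Pi.zero_apply]
  · rw [Fin.succ_last, permLift_last]
    exact (Fin.le_last _).not_gt
  · rw [Equiv.Perm.mul_apply, ← Fin.succ_last, adjSwap_succ, permLift_castSucc, Fin.succ_last]
    exact (Fin.castSucc_lt_last _).ne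

/-- At `T = z`, Ocneanu's trace is the coordinate at the identity. -/
theorem IsOcneanuTrace.eval_eq {tr : ∀ m : ℕ, HeckeAlgebra m →ₗ[ℤ[X]] ℤ[X][X]}
    (h : IsOcneanuTrace tr) {m : ℕ} (x : HeckeAlgebra m) :
    (tr m x).eval Polynomial.X = heckeCoord m x 1 := by
  induction m with
  | zero =>
    obtain ⟨r, rfl⟩ := x.exists_eq_algebraMap
    rw [Algebra.algebraMap_eq_smul_one, map_smul, map_smul, h.map_one, heckeCoord_one]
    simp
  | succ m ih =>
    have hlift (x : HeckeAlgebra (m + 1)) : heckeCoord (m + 1) x 1 =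
        permRestrict m (heckeCoord (m + 1) x) 1 := by
      rw [permRestrict_apply, permLift_one]
    induction x using HeckeAlgebra.succ_induction with
    | incl x =>
      rw [h.incl, ih, hlift, heckeCoord_apply (heckeIncl m x), permRestrict_heckeRep,
        permRestrict_permVec_one, heckeCoord_apply]
    | mid x y =>
      -- Both sides vanish: the trace has the factor `T - z`, and `σ_n⁻¹` moves `y e_1` off the
      -- permutations that fix the last letter.
      rw [h.mid, hlift, mul_assoc, heckeCoord_mul, permRestrict_heckeRep, heckeCoord_mul,
        heckeRep_heckeGen, permRestrict_negOp_last, map_zero]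
      · simp
      · intro w hw
        refine heckeRep_incl_eq_zero y (fun w hw => ?_) w hw
        rw [permVec, Pi.single_apply, if_neg]
        rintro rfl
        exact hw rfl
    | add x y hx hy => rw [map_add, map_add, Polynomial.eval_add, hx, hy]; rfl

-- `H_β` is `v^{-m}` times a power series in `v`, so the coefficient of `v^{-m}` is the value of
-- that series at `v = 0`. There `1 - v²` and its inverse become `1`, hence `T` becomes `z`, and the
-- remaining `z^{-m}` cancels against `z^m`.
open HomflyRing in
theorem leftColumn_eq_toLaurent {m : ℕ} (β : BraidGroup m) :
    leftColumn β =
      Polynomial.toLaurent ((ocneanuTrace m (toHecke m β)).eval Polynomial.X) := by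
  set P := ocneanuTrace m (toHecke m β)
  have hu : IsUnit (1 - PowerSeries.X ^ 2 : PowerSeries ℤ[T;T⁻¹]) := by
    rw [PowerSeries.isUnit_iff_constantCoeff]
    simp
  obtain ⟨w, hw⟩ := hu.exists_right_inv
  have hw0 : PowerSeries.constantCoeff w = 1 := by
    have := congrArg PowerSeries.constantCoeff hw
    simpa using this
  have hv : (1 - v ^ 2 : HomflyRing) =
      HahnSeries.ofPowerSeries ℤ ℤ[T;T⁻¹] (1 - PowerSeries.X ^ 2) := by
    rw [map_sub, map_one, map_pow, HahnSeries.ofPowerSeries_X]; rfl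
  have hinv : Ring.inverse (1 - v ^ 2 : HomflyRing) = HahnSeries.ofPowerSeries ℤ ℤ[T;T⁻¹] w := by
    have h1 : (1 - v ^ 2 : HomflyRing) * HahnSeries.ofPowerSeries ℤ ℤ[T;T⁻¹] w = 1 := by
      rw [hv, ← map_mul, hw, map_one]
    calc Ring.inverse (1 - v ^ 2 : HomflyRing)
        = Ring.inverse (1 - v ^ 2) * ((1 - v ^ 2) * HahnSeries.ofPowerSeries ℤ ℤ[T;T⁻¹] w) := by
          rw [h1, mul_one]
      _ = _ := by rw [← mul_assoc, Ring.inverse_mul_cancel _ isUnit_one_sub_v_sq, one_mul]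
  have hofPoly : ofPoly = ((HahnSeries.ofPowerSeries ℤ ℤ[T;T⁻¹]).comp PowerSeries.C).comp
      (Polynomial.toLaurent : ℤ[X] →+* ℤ[T;T⁻¹]) := by
    refine RingHom.ext fun p => ?_
    simp [ofPoly]
  have hz : z = HahnSeries.ofPowerSeries ℤ ℤ[T;T⁻¹] (PowerSeries.C (LaurentPolynomial.T 1)) := by
    simp [z]
  have hzInv : zInv =
      HahnSeries.ofPowerSeries ℤ ℤ[T;T⁻¹] (PowerSeries.C (LaurentPolynomial.T (-1))) := by
    simp [zInv]
  have hv' : vInv - v = HahnSeries.single (-1) 1 * (1 - v ^ 2) := by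
    rw [mul_sub, mul_one, vInv, v, HahnSeries.single_pow, HahnSeries.single_mul_single]
    simp
  have h : framedHomfly β = HahnSeries.single (-(m : ℤ)) 1 * HahnSeries.ofPowerSeries ℤ ℤ[T;T⁻¹]
      ((1 - PowerSeries.X ^ 2) ^ m * PowerSeries.C (LaurentPolynomial.T (-1)) ^ m *
        Polynomial.eval₂ (PowerSeries.C.comp (Polynomial.toLaurent : ℤ[X] →+* ℤ[T;T⁻¹]))
          (PowerSeries.C (LaurentPolynomial.T 1) * w) P) := by
    rw [framedHomfly, hinv, hz, hzInv, hv', hv, hofPoly, ← map_mul, RingHom.comp_assoc,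
      ← Polynomial.hom_eval₂, mul_pow, mul_pow, HahnSeries.single_pow]
    simp only [map_mul, map_pow, one_pow, nsmul_eq_mul, mul_neg, mul_one, mul_assoc]
    rfl
  rw [leftColumn, h]
  have hc := HahnSeries.coeff_single_mul_add (r := (1 : ℤ[T;T⁻¹]))
    (x := HahnSeries.ofPowerSeries ℤ ℤ[T;T⁻¹]
      ((1 - PowerSeries.X ^ 2) ^ m * PowerSeries.C (LaurentPolynomial.T (-1)) ^ m *
        Polynomial.eval₂ (PowerSeries.C.comp (Polynomial.toLaurent : ℤ[X] →+* ℤ[T;T⁻¹]))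
          (PowerSeries.C (LaurentPolynomial.T 1) * w) P)) (a := ((0 : ℕ) : ℤ)) (b := -(m : ℤ))
  rw [HahnSeries.ofPowerSeries_apply_coeff, Nat.cast_zero, zero_add, one_mul] at hc
  rw [hc, PowerSeries.coeff_zero_eq_constantCoeff_apply, map_mul, map_mul, map_pow, map_pow,
    map_sub, map_one, map_pow, PowerSeries.constantCoeff_X, PowerSeries.constantCoeff_C,
    Polynomial.hom_eval₂, map_mul, hw0, PowerSeries.constantCoeff_C, LaurentPolynomial.T_pow]
  rw [← mul_assoc, ← mul_assoc, Polynomial.eval, Polynomial.hom_eval₂, Polynomial.toLaurent_X,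
    RingHom.comp_id, mul_one]
  have : LaurentPolynomial.T (m : ℤ) * (1 - 0 ^ 2) ^ m * LaurentPolynomial.T ((m : ℤ) * -1) =
      (1 : ℤ[T;T⁻¹]) := by
    rw [zero_pow two_ne_zero, sub_zero, one_pow, mul_one, ← LaurentPolynomial.T_add,
      mul_neg_one, add_neg_cancel, LaurentPolynomial.T_zero]
  rw [this, one_mul]
  rfl

theorem leftColumn_eq {m : ℕ} (β : BraidGroup m) :
    leftColumn β = Polynomial.toLaurent (heckeCoord m (toHecke m β) 1) := by
  rw [leftColumn_eq_toLaurent, isOcneanuTrace_ocneanuTrace.eval_eq]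

theorem leftColumn_mul_comm {m : ℕ} (α β : BraidGroup m) :
    leftColumn (α * β) = leftColumn (β * α) := by
  rw [leftColumn_eq_toLaurent, leftColumn_eq_toLaurent, map_mul (toHecke m), map_mul (toHecke m),
    isOcneanuTrace_ocneanuTrace.mul_comm]

/-! ### The left inner product -/

/-- `posOp i` is the permutation operator of the involution `v ↦ v s_i` plus a diagonal operator,
and both are symmetric. -/
theorem dotProduct_posOp {m : ℕ} (i : Fin m) (f g : PermModule m) :
    f ⬝ᵥ posOp i g = posOp i f ⬝ᵥ g := by
  simp only [dotProduct, posOp_apply, mul_add, add_mul, Finset.sum_add_distrib]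
  congr 1
  · rw [← Equiv.sum_comp (Equiv.mulRight (adjSwap i))]
    simp only [Equiv.coe_mulRight, mul_assoc, adjSwap_mul_self, mul_one]
  · refine Finset.sum_congr rfl fun v _ => ?_
    split_ifs <;> ring

theorem dotProduct_negOp {m : ℕ} (i : Fin m) (f g : PermModule m) :
    f ⬝ᵥ negOp i g = negOp i f ⬝ᵥ g := by
  have h (f : PermModule m) : posOp i (negOp i f) = f :=
    LinearMap.congr_fun (posOp_mul_negOp i) f
  calc f ⬝ᵥ negOp i g = posOp i (negOp i f) ⬝ᵥ negOp i g := by rw [h]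
    _ = negOp i f ⬝ᵥ g := by rw [← dotProduct_posOp, h]

theorem braidRev_mul {m : ℕ} (α β : BraidGroup m) :
    braidRev (α * β) = braidRev β * braidRev α := by
  rw [braidRev, map_mul, MulOpposite.unop_mul]; rfl

theorem braidRev_one (m : ℕ) : braidRev (1 : BraidGroup m) = 1 := by
  rw [braidRev, map_one, MulOpposite.unop_one]

theorem braidRev_braidGen {m : ℕ} (i : Fin m) : braidRev (braidGen i) = braidGen i := by
  rw [braidRev, braidRevHom, braidLift_braidGen, MulOpposite.unop_op]

theorem braidRev_inv {m : ℕ} (β : BraidGroup m) : braidRev β⁻¹ = (braidRev β)⁻¹ := by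
  rw [braidRev, map_inv, MulOpposite.unop_inv]; rfl

/-- The reverse of a braid acts as the adjoint operator. -/
theorem dotProduct_heckeRep_braidRev {m : ℕ} (β : BraidGroup m) (f g : PermModule m) :
    f ⬝ᵥ heckeRep m (toHecke m (braidRev β)) g = heckeRep m (toHecke m β) f ⬝ᵥ g := by
  obtain ⟨w, rfl⟩ := PresentedGroup.mk_surjective (braidRels m) β
  induction w using FreeGroup.induction_on generalizing f g with
  | C1 => rw [map_one, braidRev_one, map_one, map_one]; rfl
  | of i =>
    change f ⬝ᵥ heckeRep m (toHecke m (braidRev (braidGen i))) g =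
      heckeRep m (toHecke m (braidGen i)) f ⬝ᵥ g
    rw [braidRev_braidGen, heckeRep_braidGen, dotProduct_posOp]
  | inv_of i _ =>
    change f ⬝ᵥ heckeRep m (toHecke m (braidRev (braidGen i)⁻¹)) g = heckeRep m (heckeGen i) f ⬝ᵥ g
    rw [braidRev_inv, braidRev_braidGen]
    change f ⬝ᵥ heckeRep m (heckeGen i) g = heckeRep m (heckeGen i) f ⬝ᵥ g
    rw [heckeRep_heckeGen, dotProduct_negOp]
  | mul x y hx hy =>
    rw [map_mul, braidRev_mul, map_mul, map_mul, map_mul, map_mul, Module.End.mul_apply,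
      Module.End.mul_apply, hy, hx]

/-- By cyclicity and adjointness, `L_{βν*} = L_{ν*β} = ⟨e_1, ν*β e_1⟩ = ⟨ν e_1, β e_1⟩`, where `ν =
ν_π` and `ν e_1 = e_{π⁻¹}`. -/
theorem leftInner_negPermBraid {m : ℕ} (β : BraidGroup m) (π : Equiv.Perm (Fin (m + 1))) :
    leftInner β (negPermBraid π) =
      Polynomial.toLaurent (heckeCoord m (toHecke m β) π⁻¹) := by
  have h := dotProduct_heckeRep_braidRev (negPermBraid π) (permVec 1) (heckeCoord m (toHecke m β))
  rw [← heckeCoord_apply, heckeCoord_negPermBraid, single_one_dotProduct,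
    single_one_dotProduct, ← heckeCoord_mul, ← map_mul] at h
  rw [leftInner, leftColumn_mul_comm, leftColumn_eq, h]

/-! ### Scanning a front from left to right -/

/-- The effect of one event on the list of strands. -/
def frontStep (S : Finset ℕ) (i : ℕ) (e : FrontEvent) (l : List (ℕ × Bool)) : List (ℕ × Bool) :=
  match e with
  | .leftCusp k _ => l.take k ++ [(i, false), (i, true)] ++ l.drop k
  | .crossing k =>
      if i ∈ S then l else l.take k ++ ((l.drop k).take 2).reverse ++ l.drop (k + 2)
  | .rightCusp k => l.take k ++ l.drop (k + 2)

/-- The effect of a list of events, the first of which has the number `i`. -/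
def frontRun (S : Finset ℕ) : ℕ → List (ℕ × Bool) → List FrontEvent → List (ℕ × Bool)
  | _, l, [] => l
  | i, l, e :: es => frontRun S (i + 1) (frontStep S i e l) es

/-- The condition `P` holds at each event of a list, the first of which has the number `i`. -/
def FrontAlong (S : Finset ℕ) (P : ℕ → FrontEvent → List (ℕ × Bool) → Prop) :
    ℕ → List (ℕ × Bool) → List FrontEvent → Prop
  | _, _, [] => True
  | i, l, e :: es => P i e l ∧ FrontAlong S P (i + 1) (frontStep S i e l) es

theorem frontStrands_succ {f : List FrontEvent} {S : Finset ℕ} {i : ℕ} {e : FrontEvent}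
    (h : f[i]? = some e) :
    frontStrands f S (i + 1) = frontStep S i e (frontStrands f S i) := by
  rw [frontStrands, h]
  cases e <;> rfl

theorem frontRun_append (S : Finset ℕ) (i : ℕ) (l : List (ℕ × Bool)) (es es' : List FrontEvent) :
    frontRun S i l (es ++ es') = frontRun S (i + es.length) (frontRun S i l es) es' := by
  induction es generalizing i l with
  | nil => rfl
  | cons e es ih =>
    rw [List.cons_append, frontRun, frontRun, ih, List.length_cons, add_assoc, add_comm 1]

theorem frontAlong_append (S : Finset ℕ) (P : ℕ → FrontEvent → List (ℕ × Bool) → Prop) (i : ℕ)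
    (l : List (ℕ × Bool)) (es es' : List FrontEvent) :
    FrontAlong S P i l (es ++ es') ↔
      FrontAlong S P i l es ∧ FrontAlong S P (i + es.length) (frontRun S i l es) es' := by
  induction es generalizing i l with
  | nil => simp [FrontAlong, frontRun]
  | cons e es ih =>
    rw [List.cons_append, FrontAlong, FrontAlong, ih, List.length_cons, frontRun, add_assoc,
      add_comm 1, and_assoc]

theorem frontAlong_drop_iff (f : List FrontEvent) (S : Finset ℕ)
    (P : ℕ → FrontEvent → List (ℕ × Bool) → Prop) (es : List FrontEvent) (i : ℕ)
    (h : f.drop i = es) :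
    FrontAlong S P i (frontStrands f S i) es ↔
      ∀ j, i ≤ j → ∀ e, f[j]? = some e → P j e (frontStrands f S j) := by
  induction es generalizing i with
  | nil =>
    refine ⟨fun _ j hj e he => ?_, fun _ => trivial⟩
    rw [List.drop_eq_nil_iff] at h
    rw [List.getElem?_eq_none (h.trans hj)] at he
    cases he
  | cons e es ih =>
    have he : f[i]? = some e := by
      have := congrArg (fun l : List FrontEvent => l[0]?) h
      simpa using this
    have hd : f.drop (i + 1) = es := by
      rw [← List.tail_drop, h, List.tail_cons]
    rw [FrontAlong, ← frontStrands_succ he, ih _ hd]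
    constructor
    · rintro ⟨h0, h1⟩ j hj e' he'
      rcases hj.eq_or_lt with rfl | hj
      · rw [he] at he'
        cases he'
        exact h0
      · exact h1 j hj e' he'
    · intro H
      exact ⟨H i le_rfl e he, fun j hj => H j (by omega)⟩

/-- This trades conditions quantified over event numbers for a recursion along the list, which can
be cut at the boundaries between cusps, braid and tangle by `frontAlong_append`. -/
theorem frontAlong_iff (f : List FrontEvent) (S : Finset ℕ)
    (P : ℕ → FrontEvent → List (ℕ × Bool) → Prop) :
    FrontAlong S P 0 [] f ↔ ∀ j e, f[j]? = some e → P j e (frontStrands f S j) := by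
  simpa [frontStrands] using frontAlong_drop_iff f S P f 0 (by simp)

theorem frontRun_drop (f : List FrontEvent) (S : Finset ℕ) (es : List FrontEvent) (i : ℕ)
    (h : f.drop i = es) (hi : i ≤ f.length) :
    frontRun S i (frontStrands f S i) es = frontStrands f S f.length := by
  induction es generalizing i with
  | nil =>
    rw [List.drop_eq_nil_iff] at h
    rw [frontRun, le_antisymm hi h]
  | cons e es ih =>
    have he : f[i]? = some e := by
      have := congrArg (fun l : List FrontEvent => l[0]?) h
      simpa using this
    have hd : f.drop (i + 1) = es := by
      rw [← List.tail_drop, h, List.tail_cons]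
    rw [frontRun, ← frontStrands_succ he]
    exact ih _ hd (List.getElem?_eq_some_iff.mp he).1

theorem frontRun_eq_frontStrands (f : List FrontEvent) (S : Finset ℕ) :
    frontRun S 0 [] f = frontStrands f S f.length := by
  simpa [frontStrands] using frontRun_drop f S f 0 (by simp) (Nat.zero_le _)

/-- The eye of the strand in position `k`. -/
def eyeOf (l : List (ℕ × Bool)) (k : ℕ) : Option ℕ := (l[k]?).map Prod.fst

/-- The segment in which a vertical line meets the interior of the eye `e`. -/
def segmentOf (l : List (ℕ × Bool)) (e : Option ℕ) : Set ℕ :=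
  {h | ∃ a b, a ≤ h ∧ h < b ∧ b < l.length ∧ eyeOf l a = e ∧ eyeOf l b = e}

/-- The condition of an oriented front at one event. -/
def FrontCond (dir : ℕ × Bool → Bool) (_ : ℕ) (e : FrontEvent) (l : List (ℕ × Bool)) : Prop :=
  match e with
  | .leftCusp k _ => k ≤ l.length
  | .crossing k => k + 1 < l.length
  | .rightCusp k => k + 1 < l.length ∧ (l[k]?).map dir ≠ (l[k + 1]?).map dir

/-- The condition of a ruling at one event. -/
def RulingCond (S : Finset ℕ) (i : ℕ) (e : FrontEvent) (l : List (ℕ × Bool)) : Prop :=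
  match e with
  | .leftCusp _ _ => True
  | .crossing k => eyeOf l k ≠ eyeOf l (k + 1) ∧ (i ∈ S →
      Disjoint (segmentOf l (eyeOf l k)) (segmentOf l (eyeOf l (k + 1))) ∨
      segmentOf l (eyeOf l k) ⊆ segmentOf l (eyeOf l (k + 1)) ∨
      segmentOf l (eyeOf l (k + 1)) ⊆ segmentOf l (eyeOf l k))
  | .rightCusp k => eyeOf l k = eyeOf l (k + 1)

theorem isOrientedFront_of_frontAlong {f : List FrontEvent}
    (h : FrontAlong ∅ (FrontCond (strandRightward f)) 0 [] f) (h' : frontRun ∅ 0 [] f = []) :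
    IsOrientedFront f := by
  rw [frontAlong_iff] at h
  exact ⟨fun i k up hi => h i _ hi, fun i k hi => h i _ hi, fun i k hi => h i _ hi,
    by rw [← frontRun_eq_frontStrands, h']⟩

/-- The fields `simple` and `switch` together say that two different eyes meet at every crossing,
smoothed or not. -/
theorem isOrientedRuling_iff {f : List FrontEvent} {S : Finset ℕ} :
    IsOrientedRuling f S ↔
      (∀ i ∈ S, IsPositiveCrossing f i) ∧ FrontAlong S (RulingCond S) 0 [] f := by
  rw [frontAlong_iff]
  constructor
  · intro h
    refine ⟨h.positive, fun i e he => ?_⟩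
    cases e with
    | leftCusp k up => trivial
    | crossing k =>
      refine ⟨?_, fun hi => h.normal i k he hi⟩
      by_cases hi : i ∈ S
      · exact h.switch i k he hi
      · exact h.simple i k he hi
    | rightCusp k => exact h.cusps i k he
  · rintro ⟨hpos, h⟩
    exact ⟨hpos, fun i k hi => h i _ hi, fun i k hi _ => (h i _ hi).1,
      fun i k hi _ => (h i _ hi).1, fun i k hi hS => (h i _ hi).2 hS⟩

/-! ### The parts of the front of a positive braid and a permutation -/

/-- Cusp number `k` is inserted at height `k`, just between the lower and the upper strands of the
earlier cusps, so the last cusp is the innermost. Hence the label `m - a` for the eye of the upper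
end `a` below. -/
theorem frontRun_leftCusps (S : Finset ℕ) (n : ℕ) :
    frontRun S 0 [] ((List.range n).map fun k => FrontEvent.leftCusp k true) =
      (List.range n).map (fun k => (k, false)) ++
        (List.range n).reverse.map (fun k => (k, true)) := by
  induction n with
  | zero => rfl
  | succ n ih =>
    rw [List.range_succ, List.map_append, frontRun_append, ih]
    simp [frontRun, frontStep]

theorem frontAlong_leftCusps {S : Finset ℕ} {P : ℕ → FrontEvent → List (ℕ × Bool) → Prop}
    {n : ℕ} (h : ∀ k < n, ∀ l, k ≤ l.length → P k (.leftCusp k true) l) :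
    FrontAlong S P 0 [] ((List.range n).map fun k => FrontEvent.leftCusp k true) := by
  induction n with
  | zero => trivial
  | succ n ih =>
    rw [List.range_succ, List.map_append, frontAlong_append, frontRun_leftCusps]
    refine ⟨ih fun k hk => h k (by omega), ?_, trivial⟩
    rw [List.length_map, List.length_range, zero_add]
    refine h n (by omega) _ ?_
    simp

/-- The strand from the lower end `b`, with the eye of the upper end `v b`. -/
def lowStrand {m : ℕ} (v : Equiv.Perm (Fin (m + 1))) (b : Fin (m + 1)) : ℕ × Bool :=
  (m - v b, false)

/-- The strand from the upper end `a`. -/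
def upStrand {m : ℕ} (a : Fin (m + 1)) : ℕ × Bool := (m - a, true)

/-- The list of strands in which the lower end `b` belongs to the eye of the upper end `v b`. -/
def permStrands {m : ℕ} (v : Equiv.Perm (Fin (m + 1))) : List (ℕ × Bool) :=
  (List.finRange (m + 1)).reverse.map (lowStrand v) ++ (List.finRange (m + 1)).map upStrand

theorem frontRun_leftCusps_eq_permStrands (S : Finset ℕ) (m : ℕ) :
    frontRun S 0 [] ((List.range (m + 1)).map fun k => FrontEvent.leftCusp k true) =
      permStrands (1 : Equiv.Perm (Fin (m + 1))) := by
  rw [frontRun_leftCusps, permStrands]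
  congr 1
  · refine List.ext_getElem (by simp) fun k h1 h2 => ?_
    simp only [List.length_map, List.length_range] at h1
    simp [lowStrand]
    omega
  · refine List.ext_getElem (by simp) fun k h1 h2 => ?_
    simp [upStrand]

theorem length_permStrands {m : ℕ} (v : Equiv.Perm (Fin (m + 1))) :
    (permStrands v).length = (m + 1) + (m + 1) := by
  simp [permStrands]

theorem eyeOf_permStrands_low {m : ℕ} (v : Equiv.Perm (Fin (m + 1))) (b : Fin (m + 1)) :
    eyeOf (permStrands v) (m - b) = some (m - v b) := by
  rw [eyeOf, permStrands, List.getElem?_append_left (by simp), List.getElem?_map,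
    List.getElem?_reverse (by simp), List.length_finRange,
    List.getElem?_eq_getElem (by simp), List.getElem_finRange]
  have : (⟨m + 1 - 1 - (m - b), by omega⟩ : Fin (m + 1)) = b := by
    ext; simp only; omega
  simp only [Fin.cast_mk, this, Option.map_some, lowStrand]

theorem eyeOf_permStrands_up {m : ℕ} (v : Equiv.Perm (Fin (m + 1))) (a : Fin (m + 1)) :
    eyeOf (permStrands v) (m + 1 + a) = some (m - a) := by
  rw [eyeOf, permStrands, List.getElem?_append_right (by simp)]
  have : (List.finRange (m + 1))[(a : ℕ)]? = some a := by
    rw [List.getElem?_eq_getElem (by simp; omega), List.getElem_finRange]; rfl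
  simp [upStrand, this]

/-- The eye has exactly two strands on this vertical line, one from the lower end `b` and one from
the upper end `v b`. -/
theorem segmentOf_permStrands {m : ℕ} (v : Equiv.Perm (Fin (m + 1))) (b : Fin (m + 1)) :
    segmentOf (permStrands v) (some (m - v b)) = Set.Ico (m - b : ℕ) (m + 1 + v b) := by
  have key : ∀ p < m + 1 + (m + 1), eyeOf (permStrands v) p = some (m - v b) →
      p = m - b ∨ p = m + 1 + v b := by
    intro p hp he
    rcases lt_or_ge p (m + 1) with h | h
    · left
      have h1 := eyeOf_permStrands_low v ⟨m - p, by omega⟩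
      have h2 : m - (m - p) = p := by omega
      simp only [h2] at h1
      rw [h1, Option.some_inj] at he
      have h3 := (v ⟨m - p, by omega⟩).isLt
      have h4 := (v b).isLt
      have h5 : v ⟨m - p, by omega⟩ = v b := by ext; omega
      have h6 := congrArg Fin.val (v.injective h5)
      simp only at h6
      omega
    · right
      have h1 := eyeOf_permStrands_up v ⟨p - (m + 1), by omega⟩
      have h2 : m + 1 + (p - (m + 1)) = p := by omega
      simp only [h2] at h1
      rw [h1, Option.some_inj] at he
      have h4 := (v b).isLt
      omega
  ext h
  simp only [segmentOf, Set.mem_ofPred_eq, length_permStrands, Set.mem_Ico]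
  constructor
  · rintro ⟨p, q, hp, hq, hl, h1, h2⟩
    have h1 := key p (by omega) h1
    have h2 := key q hl h2
    have := b.isLt
    omega
  · rintro ⟨h1, h2⟩
    refine ⟨m - b, m + 1 + v b, h1, h2, ?_, eyeOf_permStrands_low v b,
      eyeOf_permStrands_up v (v b)⟩
    have := (v b).isLt
    omega

theorem exists_reverse_finRange_eq {m : ℕ} (b : Fin (m + 1)) :
    ∃ A B : List (Fin (m + 1)), (List.finRange (m + 1)).reverse = A ++ b :: B ∧
      (∀ a, a ∈ A ↔ b < a) ∧ ∀ a, a ∈ B ↔ a < b := by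
  obtain ⟨A, B, h⟩ := List.append_of_mem (List.mem_reverse.mpr (List.mem_finRange b))
  have hs : (A ++ b :: B).Pairwise (· > ·) := by
    rw [← h, List.pairwise_reverse]
    exact List.pairwise_lt_finRange _
  rw [List.pairwise_append, List.pairwise_cons] at hs
  have hmem (a : Fin (m + 1)) : a ∈ A ∨ a = b ∨ a ∈ B := by
    have : a ∈ (List.finRange (m + 1)).reverse := by simp
    rw [h] at this
    simpa using this
  have hA : ∀ a ∈ A, b < a := fun a ha => hs.2.2 a ha b (by simp)
  have hB : ∀ a ∈ B, a < b := fun a ha => hs.2.1.1 a ha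
  refine ⟨A, B, h, fun a => ⟨hA a, fun ha => ?_⟩, fun a => ⟨hB a, fun ha => ?_⟩⟩
  · rcases hmem a with h | rfl | h
    · exact h
    · exact absurd ha (lt_irrefl _)
    · exact absurd ha (hB a h).not_gt
  · rcases hmem a with h | rfl | h
    · exact absurd ha (hA a h).not_gt
    · exact absurd ha (lt_irrefl _)
    · exact h

theorem exists_reverse_finRange_eq_succ {m : ℕ} (j : Fin m) :
    ∃ A B : List (Fin (m + 1)),
      (List.finRange (m + 1)).reverse = A ++ j.succ :: j.castSucc :: B ∧
      A.length = (Fin.rev j : ℕ) ∧ (∀ a ∈ A, j.succ < a) ∧ ∀ a ∈ B, a < j.castSucc := by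
  have hl : (Fin.rev j : ℕ) + 1 < (List.finRange (m + 1)).reverse.length := by
    simp only [List.length_reverse, List.length_finRange, Fin.val_rev]; omega
  have h : (List.finRange (m + 1)).reverse =
      (List.finRange (m + 1)).reverse.take (Fin.rev j) ++ j.succ :: j.castSucc ::
        (List.finRange (m + 1)).reverse.drop (Fin.rev j + 1 + 1) := by
    conv_lhs => rw [← List.take_append_drop (Fin.rev j) (List.finRange (m + 1)).reverse,
      List.drop_eq_getElem_cons (by omega), List.drop_eq_getElem_cons hl]
    congr 3
    · ext; simp; omega
    · ext; simp; omega
  have hs : ((List.finRange (m + 1)).reverse).Pairwise (· > ·) := by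
    rw [List.pairwise_reverse]
    exact List.pairwise_lt_finRange _
  rw [h, List.pairwise_append, List.pairwise_cons, List.pairwise_cons] at hs
  exact ⟨_, _, h, by rw [List.length_take]; omega, fun a ha => hs.2.2 a ha _ (by simp),
    hs.2.1.2.1⟩

theorem frontStep_crossing {S : Finset ℕ} {i : ℕ} (hi : i ∉ S) (X Y : List (ℕ × Bool))
    (x y : ℕ × Bool) :
    frontStep S i (.crossing X.length) (X ++ x :: y :: Y) = X ++ y :: x :: Y := by
  simp [frontStep, hi, List.drop_append]

theorem frontStep_rightCusp {S : Finset ℕ} {i : ℕ} (X Y : List (ℕ × Bool)) (x y : ℕ × Bool) :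
    frontStep S i (.rightCusp X.length) (X ++ x :: y :: Y) = X ++ Y := by
  simp [frontStep, List.drop_append]

/-- A crossing that is kept exchanges the eyes of the lower ends `j` and `j + 1`, which is right
multiplication by `s_j`. -/
theorem frontStep_permStrands {m : ℕ} (S : Finset ℕ) (i : ℕ) (v : Equiv.Perm (Fin (m + 1)))
    (j : Fin m) :
    frontStep S i (.crossing (Fin.rev j)) (permStrands v) =
      permStrands (if i ∈ S then v else v * adjSwap j) := by
  by_cases hi : i ∈ S
  · simp [frontStep, hi]
  · obtain ⟨A, B, h, hl, hA, hB⟩ := exists_reverse_finRange_eq_succ j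
    have hA' : A.map (lowStrand (v * adjSwap j)) = A.map (lowStrand v) := by
      refine List.map_congr_left fun a ha => ?_
      have := hA a ha
      rw [lowStrand, Equiv.Perm.mul_apply, adjSwap_of_ne
        ((Fin.castSucc_lt_succ).trans this).ne' this.ne']; rfl
    have hB' : B.map (lowStrand (v * adjSwap j)) = B.map (lowStrand v) := by
      refine List.map_congr_left fun a ha => ?_
      have := hB a ha
      rw [lowStrand, Equiv.Perm.mul_apply, adjSwap_of_ne this.ne
        (this.trans Fin.castSucc_lt_succ).ne]; rfl
    have h1 : lowStrand (v * adjSwap j) j.succ = lowStrand v j.castSucc := by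
      rw [lowStrand, Equiv.Perm.mul_apply, adjSwap_succ]; rfl
    have h2 : lowStrand (v * adjSwap j) j.castSucc = lowStrand v j.succ := by
      rw [lowStrand, Equiv.Perm.mul_apply, adjSwap_castSucc]; rfl
    rw [if_neg hi, permStrands, permStrands, h]
    simp only [List.map_append, List.map_cons, hA', hB', h1, h2, List.append_assoc,
      List.cons_append]
    rw [← hl, ← List.length_map (lowStrand v) (as := A), frontStep_crossing hi]

/-- The permutation after the crossings of the word `u`, the first of which has the number `i`,
if those in `S` are smoothed. -/
def pathPerm {m : ℕ} (S : Finset ℕ) :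
    ℕ → Equiv.Perm (Fin (m + 1)) → List (Fin m) → Equiv.Perm (Fin (m + 1))
  | _, v, [] => v
  | i, v, j :: u => pathPerm S (i + 1) (if i ∈ S then v else v * adjSwap j) u

/-- Crossings are smoothed only where the permutation increases. -/
def PathValid {m : ℕ} (S : Finset ℕ) : ℕ → Equiv.Perm (Fin (m + 1)) → List (Fin m) → Prop
  | _, _, [] => True
  | i, v, j :: u => (i ∈ S → v j.castSucc < v j.succ) ∧
      PathValid S (i + 1) (if i ∈ S then v else v * adjSwap j) u

theorem frontRun_crossings {m : ℕ} (S : Finset ℕ) (i : ℕ) (v : Equiv.Perm (Fin (m + 1)))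
    (u : List (Fin m)) :
    frontRun S i (permStrands v) (u.map fun j => FrontEvent.crossing (Fin.rev j : ℕ)) =
      permStrands (pathPerm S i v u) := by
  induction u generalizing i v with
  | nil => rfl
  | cons j u ih => rw [List.map_cons, frontRun, frontStep_permStrands, ih, pathPerm]

theorem frontAlong_crossings {m : ℕ} {S : Finset ℕ}
    {P : ℕ → FrontEvent → List (ℕ × Bool) → Prop} {i : ℕ} {v : Equiv.Perm (Fin (m + 1))}
    {u : List (Fin m)}
    (h : ∀ k, i ≤ k → k < i + u.length → ∀ (v : Equiv.Perm (Fin (m + 1))) (j : Fin m),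
      P k (.crossing (Fin.rev j : ℕ)) (permStrands v)) :
    FrontAlong S P i (permStrands v) (u.map fun j => FrontEvent.crossing (Fin.rev j : ℕ)) := by
  induction u generalizing i v with
  | nil => trivial
  | cons j u ih =>
    rw [List.length_cons] at h
    rw [List.map_cons, FrontAlong, frontStep_permStrands]
    exact ⟨h i le_rfl (by omega) v j, ih fun k hk hk' => h k (by omega) (by omega)⟩

theorem rulingCond_permStrands {m : ℕ} (S : Finset ℕ) (i : ℕ) (v : Equiv.Perm (Fin (m + 1)))
    (j : Fin m) :
    RulingCond S i (.crossing (Fin.rev j)) (permStrands v) ↔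
      (i ∈ S → v j.castSucc < v j.succ) := by
  have h1 := eyeOf_permStrands_low v j.succ
  have h2 := eyeOf_permStrands_low v j.castSucc
  have e1 : m - (j.succ : ℕ) = (Fin.rev j : ℕ) := by simp [Fin.val_rev]
  have e2 : m - (j.castSucc : ℕ) = (Fin.rev j : ℕ) + 1 := by
    rw [Fin.val_rev, Fin.val_castSucc]; omega
  rw [RulingCond, ← e1, h1, e1, ← e2, h2, segmentOf_permStrands, segmentOf_permStrands, e1, e2]
  have hne : v j.succ ≠ v j.castSucc := v.injective.ne (Fin.castSucc_lt_succ).ne'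
  have hlt1 := (v j.succ).isLt
  have hlt2 := (v j.castSucc).isLt
  have hr := (Fin.rev j).isLt
  have hne' : (v j.succ : ℕ) ≠ v j.castSucc := Fin.val_ne_of_ne hne
  -- Every eye contains the interval of height `m` between the lower and the upper strands. So the
  -- eyes must be nested, and the one that reaches lower, that of `j + 1`, must also reach higher.
  have hd : ¬ Disjoint (Set.Ico (Fin.rev j : ℕ) (m + 1 + v j.succ))
      (Set.Ico (Fin.rev j + 1 : ℕ) (m + 1 + v j.castSucc)) := by
    rw [Set.not_disjoint_iff]
    exact ⟨m, ⟨by omega, by omega⟩, ⟨by omega, by omega⟩⟩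
  rw [and_iff_right (by rw [Ne, Option.some_inj]; omega), or_iff_right hd,
    Set.Ico_subset_Ico_iff (by omega), Set.Ico_subset_Ico_iff (by omega), Fin.lt_def]
  constructor <;> intro h hi <;> have := h hi <;> omega

theorem frontAlong_rulingCond_crossings {m : ℕ} (S : Finset ℕ) (i : ℕ)
    (v : Equiv.Perm (Fin (m + 1))) (u : List (Fin m)) :
    FrontAlong S (RulingCond S) i (permStrands v)
      (u.map fun j => FrontEvent.crossing (Fin.rev j : ℕ)) ↔ PathValid S i v u := by
  induction u generalizing i v with
  | nil => rfl
  | cons j u ih =>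
    rw [List.map_cons, FrontAlong, frontStep_permStrands, ih, PathValid, rulingCond_permStrands]

/-! ### The tangle of a permutation -/

/-- The number of crossings on the strand from the upper end `a` in `permTangle ρ`. -/
def tangleCount {m : ℕ} (ρ : Equiv.Perm (Fin (m + 1))) (a : Fin (m + 1)) : ℕ :=
  (Finset.univ.filter fun b : Fin (m + 1) => b < ρ⁻¹ a ∧ a < ρ b).card

/-- The events of `permTangle ρ` on the strand from the upper end `a`. -/
def tangleBlock {m : ℕ} (ρ : Equiv.Perm (Fin (m + 1))) (a : Fin (m + 1)) : List FrontEvent :=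
  (List.range (tangleCount ρ a)).map (fun t => FrontEvent.crossing ((m - a) - t)) ++
    [FrontEvent.rightCusp ((m - a) - tangleCount ρ a)]

theorem permTangle_eq {m : ℕ} (ρ : Equiv.Perm (Fin (m + 1))) :
    permTangle ρ = (List.finRange (m + 1)).flatMap (tangleBlock ρ) := rfl

/-- The lower ends whose strands are present just before the block of the upper end `a`, from
bottom to top. -/
def remainingEnds {m : ℕ} (ρ : Equiv.Perm (Fin (m + 1))) (a : ℕ) : List (Fin (m + 1)) :=
  (List.finRange (m + 1)).reverse.filter fun b => a ≤ (ρ b : ℕ)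

/-- The strands just before the block of the upper end `a`. -/
def tangleStrands {m : ℕ} (ρ v : Equiv.Perm (Fin (m + 1))) (a : ℕ) : List (ℕ × Bool) :=
  (remainingEnds ρ a).map (lowStrand v) ++ ((List.finRange (m + 1)).drop a).map upStrand

theorem tangleStrands_zero {m : ℕ} (ρ v : Equiv.Perm (Fin (m + 1))) :
    tangleStrands ρ v 0 = permStrands v := by
  simp [tangleStrands, remainingEnds, permStrands]

theorem nodup_remainingEnds {m : ℕ} (ρ : Equiv.Perm (Fin (m + 1))) (a : ℕ) :
    (remainingEnds ρ a).Nodup :=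
  (List.nodup_reverse.mpr (List.nodup_finRange _)).filter _

theorem length_remainingEnds {m : ℕ} (ρ : Equiv.Perm (Fin (m + 1))) (a : Fin (m + 1)) :
    (remainingEnds ρ a).length = m + 1 - a := by
  rw [← List.toFinset_card_of_nodup (nodup_remainingEnds ρ a), ← Fin.card_Ici,
    ← Finset.card_map ρ.toEmbedding]
  congr 1
  ext c
  simp only [remainingEnds, Finset.mem_map_equiv, List.mem_toFinset, List.mem_filter,
    List.mem_reverse, List.mem_finRange, true_and, decide_eq_true_eq, Finset.mem_Ici,
    Equiv.apply_symm_apply, Fin.le_def]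

/-- `B` consists of the remaining ends above `ρ⁻¹ a`. They separate that strand from the upper
strand `a`, so they are exactly the ones that `a` has to cross before its cusp. -/
theorem exists_remainingEnds_eq {m : ℕ} (ρ : Equiv.Perm (Fin (m + 1))) (a : Fin (m + 1)) :
    ∃ A B : List (Fin (m + 1)), remainingEnds ρ a = A ++ ρ⁻¹ a :: B ∧
      remainingEnds ρ (a + 1) = A ++ B ∧ B.length = tangleCount ρ a ∧
      A.length + B.length = m - a ∧ ∀ b ∈ B, ρ b ≠ a := by
  obtain ⟨A, B, h, hA, hB⟩ := exists_reverse_finRange_eq (ρ⁻¹ a)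
  have ha : ρ (ρ⁻¹ a) = a := perm_apply_inv_apply ρ a
  have hne : ∀ b, b ≠ ρ⁻¹ a → ρ b ≠ a := fun b hb hba => hb (ρ.injective (hba.trans ha.symm))
  have hsucc : ∀ b, b ≠ ρ⁻¹ a →
      decide ((a : ℕ) + 1 ≤ (ρ b : ℕ)) = decide ((a : ℕ) ≤ (ρ b : ℕ)) := by
    intro b hb
    have : (ρ b : ℕ) ≠ a := Fin.val_ne_of_ne (hne b hb)
    rw [decide_eq_decide]
    omega
  have h1 : remainingEnds ρ a = A.filter (fun b => (a : ℕ) ≤ (ρ b : ℕ)) ++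
      ρ⁻¹ a :: B.filter (fun b => (a : ℕ) ≤ (ρ b : ℕ)) := by
    rw [remainingEnds, h, List.filter_append, List.filter_cons_of_pos (by simp)]
  have h2 : remainingEnds ρ (a + 1) = A.filter (fun b => (a : ℕ) ≤ (ρ b : ℕ)) ++
      B.filter (fun b => (a : ℕ) ≤ (ρ b : ℕ)) := by
    rw [remainingEnds, h, List.filter_append, List.filter_cons_of_neg (by simp)]
    congr 1
    · exact List.filter_congr fun b hb => hsucc b ((hA b).mp hb).ne'
    · exact List.filter_congr fun b hb => hsucc b ((hB b).mp hb).ne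
  refine ⟨_, _, h1, h2, ?_, ?_, fun b hb => ?_⟩
  · have hnd : (B.filter (fun b => (a : ℕ) ≤ (ρ b : ℕ))).Nodup := by
      have := nodup_remainingEnds ρ a
      rw [h1] at this
      exact (List.nodup_cons.mp this.of_append_right).2
    rw [← List.toFinset_card_of_nodup hnd, tangleCount]
    congr 1
    ext b
    simp only [List.mem_toFinset, List.mem_filter, hB, decide_eq_true_eq, Finset.mem_filter,
      Finset.mem_univ, true_and, ← Fin.le_def]
    refine and_congr_right fun hb => ⟨fun h => lt_of_le_of_ne h (hne b hb.ne).symm, le_of_lt⟩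
  · have hl := length_remainingEnds ρ a
    rw [h1, List.length_append, List.length_cons] at hl
    omega
  · exact hne b ((hB b).mp (List.mem_of_mem_filter hb)).ne

/-- The strand `y` passes down through `B`, meeting its topmost element first. Hence the induction
removes elements from the end of the list. -/
theorem frontRun_crossings_down {S : Finset ℕ} {i : ℕ} (hS : ∀ k, i ≤ k → k ∉ S)
    (X B Y : List (ℕ × Bool)) (y : ℕ × Bool) :
    frontRun S i (X ++ B ++ y :: Y)
      ((List.range B.length).map fun t => FrontEvent.crossing (X.length + B.length - 1 - t)) =
      X ++ y :: B ++ Y := by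
  induction B using List.reverseRecOn generalizing i Y with
  | nil => simp [frontRun]
  | append_singleton B x ih =>
    rw [List.length_append, List.length_singleton, List.range_succ_eq_map, List.map_cons,
      List.map_map, frontRun]
    have e : X ++ (B ++ [x]) ++ y :: Y = (X ++ B) ++ x :: y :: Y := by simp
    have e' : X.length + (B.length + 1) - 1 - 0 = (X ++ B).length := by
      rw [List.length_append]; omega
    rw [e, e', frontStep_crossing (hS i le_rfl)]
    have := ih (i := i + 1) (fun k hk => hS k (by omega)) (x :: Y)
    rw [show X ++ y :: (B ++ [x]) ++ Y = X ++ y :: B ++ x :: Y by simp, ← this]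
    congr 1
    refine List.map_congr_left fun t _ => ?_
    simp only [Function.comp_apply]
    congr 1
    omega

theorem frontAlong_crossings_down {S : Finset ℕ} {P : ℕ → FrontEvent → List (ℕ × Bool) → Prop}
    {i : ℕ} (hS : ∀ k, i ≤ k → k ∉ S) (X B Y : List (ℕ × Bool)) (y : ℕ × Bool)
    (hP : ∀ k, i ≤ k → ∀ Z W, ∀ x ∈ B, P k (.crossing Z.length) (Z ++ x :: y :: W)) :
    FrontAlong S P i (X ++ B ++ y :: Y)
      ((List.range B.length).map fun t => FrontEvent.crossing (X.length + B.length - 1 - t)) := by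
  induction B using List.reverseRecOn generalizing i Y with
  | nil => trivial
  | append_singleton B x ih =>
    rw [List.length_append, List.length_singleton, List.range_succ_eq_map, List.map_cons,
      List.map_map, FrontAlong]
    have e : X ++ (B ++ [x]) ++ y :: Y = (X ++ B) ++ x :: y :: Y := by simp
    have e' : X.length + (B.length + 1) - 1 - 0 = (X ++ B).length := by
      rw [List.length_append]; omega
    rw [e, e', frontStep_crossing (hS i le_rfl)]
    refine ⟨hP i le_rfl _ _ x (by simp), ?_⟩
    have := ih (i := i + 1) (fun k hk => hS k (by omega)) (x :: Y)
      fun k hk Z W x' hx' => hP k (by omega) Z W x' (by simp [hx'])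
    convert this using 1
    refine List.map_congr_left fun t _ => ?_
    simp only [Function.comp_apply]
    congr 1
    omega

/-- One block of the tangle, in terms of the remaining lower ends `A` below and `B` above the
end that is matched with `a`. -/
theorem tangleBlock_eq {m : ℕ} {ρ : Equiv.Perm (Fin (m + 1))} {a : Fin (m + 1)}
    {A B : List (Fin (m + 1))} (hB : B.length = tangleCount ρ a)
    (hAB : A.length + B.length = m - a) (v : Equiv.Perm (Fin (m + 1))) :
    tangleBlock ρ a = (List.range (B.map (lowStrand v)).length).map (fun t =>
      FrontEvent.crossing ((A.map (lowStrand v) ++ [lowStrand v (ρ⁻¹ a)]).length +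
        (B.map (lowStrand v)).length - 1 - t)) ++
      [FrontEvent.rightCusp (A.map (lowStrand v)).length] := by
  simp only [List.length_append, List.length_map, List.length_singleton]
  rw [tangleBlock, ← hB, ← hAB]
  congr 2
  · funext t
    congr 1
    omega
  · congr 1
    omega

theorem tangleStrands_eq {m : ℕ} {ρ : Equiv.Perm (Fin (m + 1))} (v : Equiv.Perm (Fin (m + 1)))
    {a : Fin (m + 1)} {A B : List (Fin (m + 1))} (h : remainingEnds ρ a = A ++ ρ⁻¹ a :: B) :
    tangleStrands ρ v a = (A.map (lowStrand v) ++ [lowStrand v (ρ⁻¹ a)]) ++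
      B.map (lowStrand v) ++ upStrand a :: ((List.finRange (m + 1)).drop (a + 1)).map upStrand := by
  rw [tangleStrands, h, List.drop_eq_getElem_cons (by simp; omega), List.getElem_finRange]
  simp

theorem frontRun_tangleBlock {m : ℕ} {S : Finset ℕ} {i : ℕ} (hS : ∀ k, i ≤ k → k ∉ S)
    (ρ v : Equiv.Perm (Fin (m + 1))) (a : Fin (m + 1)) :
    frontRun S i (tangleStrands ρ v a) (tangleBlock ρ a) = tangleStrands ρ v (a + 1) := by
  obtain ⟨A, B, h, h', hB, hAB, -⟩ := exists_remainingEnds_eq ρ a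
  rw [tangleBlock_eq hB hAB v, tangleStrands_eq v h, frontRun_append, frontRun_crossings_down hS,
    frontRun, frontRun]
  simp only [List.append_assoc, List.nil_append, List.cons_append]
  rw [frontStep_rightCusp, tangleStrands, h', List.map_append, List.append_assoc]

/-- The condition `P` holds along a block of the tangle if it holds at crossings of unmatched
strands and at the right cusp. -/
theorem frontAlong_tangleBlock {m : ℕ} {S : Finset ℕ}
    {P : ℕ → FrontEvent → List (ℕ × Bool) → Prop} {i : ℕ} (hS : ∀ k, i ≤ k → k ∉ S)
    {ρ v : Equiv.Perm (Fin (m + 1))} {a : Fin (m + 1)}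
    (hcross : ∀ k, i ≤ k → ∀ Z W b, ρ b ≠ a →
      P k (.crossing Z.length) (Z ++ lowStrand v b :: upStrand a :: W))
    (hcusp : ∀ k, i ≤ k → ∀ Z W,
      P k (.rightCusp Z.length) (Z ++ lowStrand v (ρ⁻¹ a) :: upStrand a :: W)) :
    FrontAlong S P i (tangleStrands ρ v a) (tangleBlock ρ a) := by
  obtain ⟨A, B, h, h', hB, hAB, hne⟩ := exists_remainingEnds_eq ρ a
  rw [tangleBlock_eq hB hAB v, tangleStrands_eq v h, frontAlong_append,
    frontRun_crossings_down hS]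
  refine ⟨frontAlong_crossings_down hS _ _ _ _ fun k hk Z W x hx => ?_, ?_, trivial⟩
  · obtain ⟨b, hb, rfl⟩ := List.mem_map.mp hx
    exact hcross k hk Z W b (hne b hb)
  · simp only [List.append_assoc, List.nil_append, List.cons_append]
    exact hcusp _ (by omega) _ _

theorem exists_rightCusp_of_frontAlong_tangleBlock {m : ℕ} {S : Finset ℕ}
    {P : ℕ → FrontEvent → List (ℕ × Bool) → Prop} {i : ℕ} (hS : ∀ k, i ≤ k → k ∉ S)
    {ρ v : Equiv.Perm (Fin (m + 1))} {a : Fin (m + 1)}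
    (H : FrontAlong S P i (tangleStrands ρ v a) (tangleBlock ρ a)) :
    ∃ k Z W, P k (.rightCusp Z.length) (Z ++ lowStrand v (ρ⁻¹ a) :: upStrand a :: W) := by
  obtain ⟨A, B, h, h', hB, hAB, hne⟩ := exists_remainingEnds_eq ρ a
  rw [tangleBlock_eq hB hAB v, tangleStrands_eq v h, frontAlong_append,
    frontRun_crossings_down hS] at H
  have := H.2.1
  simp only [List.append_assoc, List.nil_append, List.cons_append] at this
  exact ⟨_, _, _, this⟩

theorem drop_finRange {m : ℕ} (a : Fin (m + 1)) :
    (List.finRange (m + 1)).drop a = a :: (List.finRange (m + 1)).drop (a + 1) := by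
  rw [List.drop_eq_getElem_cons (by simp; omega), List.getElem_finRange]
  rfl

theorem frontRun_tangle_drop {m : ℕ} {S : Finset ℕ} (ρ v : Equiv.Perm (Fin (m + 1))) (c a : ℕ)
    (hc : a + c = m + 1) {i : ℕ} (hS : ∀ k, i ≤ k → k ∉ S) :
    frontRun S i (tangleStrands ρ v a)
      (((List.finRange (m + 1)).drop a).flatMap (tangleBlock ρ)) = [] := by
  induction c generalizing a i with
  | zero =>
    obtain rfl : a = m + 1 := hc
    rw [List.drop_of_length_le (by simp), tangleStrands, List.drop_of_length_le (by simp),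
      remainingEnds, List.filter_eq_nil_iff.mpr fun b _ => by simp; omega]
    rfl
  | succ c ih =>
    obtain ⟨a, rfl⟩ : ∃ b : Fin (m + 1), (b : ℕ) = a := ⟨⟨a, by omega⟩, rfl⟩
    rw [drop_finRange, List.flatMap_cons, frontRun_append, frontRun_tangleBlock hS]
    exact ih _ (by omega) fun k hk => hS k (by omega)

theorem frontRun_permTangle {m : ℕ} {S : Finset ℕ} {i : ℕ} (hS : ∀ k, i ≤ k → k ∉ S)
    (ρ v : Equiv.Perm (Fin (m + 1))) :
    frontRun S i (permStrands v) (permTangle ρ) = [] := by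
  have := frontRun_tangle_drop ρ v (m + 1) 0 (by omega) hS
  rwa [List.drop_zero, tangleStrands_zero] at this

theorem frontAlong_tangle_drop {m : ℕ} {S : Finset ℕ}
    {P : ℕ → FrontEvent → List (ℕ × Bool) → Prop} {ρ v : Equiv.Perm (Fin (m + 1))} (c a : ℕ)
    (hc : a + c = m + 1) {i : ℕ} (hS : ∀ k, i ≤ k → k ∉ S)
    (hcross : ∀ k, i ≤ k → ∀ Z W a b, ρ b ≠ a →
      P k (.crossing Z.length) (Z ++ lowStrand v b :: upStrand a :: W))
    (hcusp : ∀ k, i ≤ k → ∀ Z W a,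
      P k (.rightCusp Z.length) (Z ++ lowStrand v (ρ⁻¹ a) :: upStrand a :: W)) :
    FrontAlong S P i (tangleStrands ρ v a)
      (((List.finRange (m + 1)).drop a).flatMap (tangleBlock ρ)) := by
  induction c generalizing a i with
  | zero => rw [List.drop_of_length_le (by simp; omega)]; trivial
  | succ c ih =>
    obtain ⟨a, rfl⟩ : ∃ b : Fin (m + 1), (b : ℕ) = a := ⟨⟨a, by omega⟩, rfl⟩
    rw [drop_finRange, List.flatMap_cons, frontAlong_append, frontRun_tangleBlock hS]
    exact ⟨frontAlong_tangleBlock hS (fun k hk Z W b => hcross k hk Z W a b)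
      (fun k hk Z W => hcusp k hk Z W a), ih _ (by omega) (fun k hk => hS k (by omega))
      (fun k hk => hcross k (by omega)) fun k hk => hcusp k (by omega)⟩

theorem frontAlong_permTangle {m : ℕ} {S : Finset ℕ}
    {P : ℕ → FrontEvent → List (ℕ × Bool) → Prop} {ρ v : Equiv.Perm (Fin (m + 1))}
    {i : ℕ} (hS : ∀ k, i ≤ k → k ∉ S)
    (hcross : ∀ k, i ≤ k → ∀ Z W a b, ρ b ≠ a →
      P k (.crossing Z.length) (Z ++ lowStrand v b :: upStrand a :: W))
    (hcusp : ∀ k, i ≤ k → ∀ Z W a,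
      P k (.rightCusp Z.length) (Z ++ lowStrand v (ρ⁻¹ a) :: upStrand a :: W)) :
    FrontAlong S P i (permStrands v) (permTangle ρ) := by
  have := frontAlong_tangle_drop (m + 1) 0 (by omega) hS hcross hcusp
  rwa [List.drop_zero, tangleStrands_zero] at this

theorem exists_rightCusp_of_frontAlong_drop {m : ℕ} {S : Finset ℕ}
    {P : ℕ → FrontEvent → List (ℕ × Bool) → Prop} {ρ v : Equiv.Perm (Fin (m + 1))} (c a : ℕ)
    (hc : a + c = m + 1) {i : ℕ} (hS : ∀ k, i ≤ k → k ∉ S)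
    (H : FrontAlong S P i (tangleStrands ρ v a)
      (((List.finRange (m + 1)).drop a).flatMap (tangleBlock ρ)))
    (a' : Fin (m + 1)) (ha' : a ≤ a') :
    ∃ k Z W, P k (.rightCusp Z.length) (Z ++ lowStrand v (ρ⁻¹ a') :: upStrand a' :: W) := by
  induction c generalizing a i with
  | zero => have := a'.isLt; omega
  | succ c ih =>
    obtain ⟨a, rfl⟩ : ∃ b : Fin (m + 1), (b : ℕ) = a := ⟨⟨a, by omega⟩, rfl⟩
    rw [drop_finRange, List.flatMap_cons, frontAlong_append, frontRun_tangleBlock hS] at H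
    rcases ha'.eq_or_lt with h | h
    · rw [← Fin.ext h]
      exact exists_rightCusp_of_frontAlong_tangleBlock hS H.1
    · exact ih _ (by omega) (fun k hk => hS k (by omega)) H.2 h

theorem exists_rightCusp_of_frontAlong {m : ℕ} {S : Finset ℕ}
    {P : ℕ → FrontEvent → List (ℕ × Bool) → Prop} {ρ v : Equiv.Perm (Fin (m + 1))}
    {i : ℕ} (hS : ∀ k, i ≤ k → k ∉ S)
    (H : FrontAlong S P i (permStrands v) (permTangle ρ)) (a : Fin (m + 1)) :
    ∃ k Z W, P k (.rightCusp Z.length) (Z ++ lowStrand v (ρ⁻¹ a) :: upStrand a :: W) := by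
  rw [← tangleStrands_zero ρ, permTangle_eq, ← List.drop_zero (l := List.finRange (m + 1))] at H
  exact exists_rightCusp_of_frontAlong_drop (m + 1) 0 (by omega) hS H a (Nat.zero_le _)

theorem getElem?_append_length {α : Type*} (Z W : List α) (x y : α) :
    (Z ++ x :: y :: W)[Z.length]? = some x ∧ (Z ++ x :: y :: W)[Z.length + 1]? = some y := by
  simp

theorem eyeOf_append_low {m : ℕ} (v : Equiv.Perm (Fin (m + 1))) (b a : Fin (m + 1))
    (Z W : List (ℕ × Bool)) :
    eyeOf (Z ++ lowStrand v b :: upStrand a :: W) Z.length =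
      eyeOf (Z ++ lowStrand v b :: upStrand a :: W) (Z.length + 1) ↔ v b = a := by
  obtain ⟨h1, h2⟩ := getElem?_append_length Z W (lowStrand v b) (upStrand a)
  rw [eyeOf, eyeOf, h1, h2, Option.map_some, Option.map_some, Option.some_inj, lowStrand, upStrand,
    Fin.ext_iff]
  have := (v b).isLt
  have := a.isLt
  simp only
  omega

/-- Nothing is smoothed in the tangle, so its right cusp on the upper end `a` forces `v (ρ⁻¹ a) =
a`. Conversely, if `v = ρ`, the strands that cross have `ρ b ≠ a` and so belong to different eyes.
-/
theorem frontAlong_rulingCond_permTangle {m : ℕ} {S : Finset ℕ}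
    {ρ v : Equiv.Perm (Fin (m + 1))} {i : ℕ} (hS : ∀ k, i ≤ k → k ∉ S) :
    FrontAlong S (RulingCond S) i (permStrands v) (permTangle ρ) ↔ v = ρ := by
  constructor
  · intro H
    have h (a : Fin (m + 1)) : v (ρ⁻¹ a) = a := by
      obtain ⟨k, Z, W, h⟩ := exists_rightCusp_of_frontAlong hS H a
      exact (eyeOf_append_low v _ a Z W).mp h
    ext b
    have := h (ρ b)
    rw [show ρ⁻¹ (ρ b) = b from ρ.symm_apply_apply b] at this
    rw [this]
  · rintro rfl
    refine frontAlong_permTangle hS (fun k hk Z W a b hb => ⟨?_, fun h => absurd h (hS k hk)⟩)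
      fun k _ Z W a => ?_
    · rw [Ne, eyeOf_append_low]
      exact hb
    · exact (eyeOf_append_low v _ a Z W).mpr (perm_apply_inv_apply v a)

/-! ### Summation over the paths -/

theorem pathPerm_insert {m : ℕ} {S : Finset ℕ} {i k : ℕ} (hk : k < i)
    (v : Equiv.Perm (Fin (m + 1))) (u : List (Fin m)) :
    pathPerm (insert k S) i v u = pathPerm S i v u := by
  induction u generalizing i v with
  | nil => rfl
  | cons j u ih =>
    rw [pathPerm, pathPerm, ih (by omega)]
    simp only [Finset.mem_insert, hk.ne', false_or]

theorem pathValid_insert {m : ℕ} {S : Finset ℕ} {i k : ℕ} (hk : k < i)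
    (v : Equiv.Perm (Fin (m + 1))) (u : List (Fin m)) :
    PathValid (insert k S) i v u ↔ PathValid S i v u := by
  induction u generalizing i v with
  | nil => rfl
  | cons j u ih =>
    rw [PathValid, PathValid, ih (by omega)]
    simp only [Finset.mem_insert, hk.ne', false_or]

open Classical in
/-- The sum over the paths from `v` to `ρ`, as a coordinate in the regular representation. -/
theorem sum_paths {m : ℕ} (ρ : Equiv.Perm (Fin (m + 1))) (u : List (Fin m)) (i : ℕ)
    (v : Equiv.Perm (Fin (m + 1))) :
    ∑ S ∈ (Finset.Ico i (i + u.length)).powerset,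
      (if PathValid S i v u ∧ pathPerm S i v u = ρ then (Polynomial.X : ℤ[X]) ^ S.card else 0) =
    heckeRep m (toHecke m (positiveBraid u)) (permVec ρ) v := by
  induction u generalizing i v with
  | nil =>
    simp only [PathValid, pathPerm, true_and, List.length_nil, add_zero, Finset.Ico_self,
      Finset.powerset_empty, Finset.sum_singleton, Finset.card_empty, pow_zero, positiveBraid,
      List.map_nil, List.prod_nil, map_one, Module.End.one_apply, Pi.single_apply]
  | cons j u ih =>
    have hI : Finset.Ico i (i + (j :: u).length) =
        insert i (Finset.Ico (i + 1) (i + 1 + u.length)) := by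
      ext k
      simp only [List.length_cons, Finset.mem_Ico, Finset.mem_insert]
      omega
    have hi : i ∉ Finset.Ico (i + 1) (i + 1 + u.length) := by simp
    -- The subsets without and with the first crossing correspond to the two terms of `posOp j`: the
    -- step to `v s_j`, and the stay at `v` with weight `z`, which is allowed at an ascent only.
    rw [hI, Finset.sum_powerset_insert hi, positiveBraid, List.map_cons, List.prod_cons, map_mul,
      map_mul, Module.End.mul_apply, heckeRep_braidGen, posOp_apply]
    change _ = heckeRep m (toHecke m (positiveBraid u)) (permVec ρ) (v * adjSwap j) +
      if _ then _ * heckeRep m (toHecke m (positiveBraid u)) (permVec ρ) v else 0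
    rw [← ih (i + 1), ← ih (i + 1)]
    congr 1
    · refine Finset.sum_congr rfl fun S hS => ?_
      have hiS : i ∉ S := fun h => hi (Finset.mem_powerset.mp hS h)
      simp only [PathValid, pathPerm, hiS, false_imp_iff, true_and, if_false]
    · split_ifs with hv
      · rw [Finset.mul_sum]
        refine Finset.sum_congr rfl fun S hS => ?_
        have hiS : i ∉ S := fun h => hi (Finset.mem_powerset.mp hS h)
        simp only [PathValid, pathPerm, Finset.mem_insert_self, forall_const, hv, true_and,
          if_true, pathValid_insert (Nat.lt_succ_self i), pathPerm_insert (Nat.lt_succ_self i),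
          Finset.card_insert_of_notMem hiS, mul_ite, mul_zero, pow_succ']
      · refine Finset.sum_eq_zero fun S _ => if_neg fun h => hv ?_
        exact h.1.1 (Finset.mem_insert_self i S)

theorem braidRev_positiveBraid {m : ℕ} (w : List (Fin m)) :
    braidRev (positiveBraid w) = positiveBraid w.reverse := by
  induction w with
  | nil => exact braidRev_one m
  | cons i w ih =>
    rw [positiveBraid, List.map_cons, List.prod_cons, braidRev_mul, braidRev_braidGen]
    change braidRev (positiveBraid w) * _ = _
    rw [ih]
    simp [positiveBraid]

/-- Adjointness, `⟨β e_1, e_ρ⟩ = ⟨e_1, β* e_ρ⟩`. The reversed word is the one read from left to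
right in the front, so the paths of `sum_paths` start at `1`, the state after the left cusps. -/
theorem heckeCoord_positiveBraid {m : ℕ} (w : List (Fin m)) (ρ : Equiv.Perm (Fin (m + 1))) :
    heckeCoord m (toHecke m (positiveBraid w)) ρ =
      heckeRep m (toHecke m (positiveBraid w.reverse)) (permVec ρ) 1 := by
  have h := dotProduct_heckeRep_braidRev (positiveBraid w) (permVec 1) (permVec ρ)
  rw [braidRev_positiveBraid, single_one_dotProduct, dotProduct_single_one] at h
  exact h.symm

/-! ### The front of a positive braid and a permutation -/

theorem braidPermFront_getElem? {m : ℕ} (w : List (Fin m)) (π : Equiv.Perm (Fin (m + 1))) {k : ℕ}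
    (hk : k ≤ m) : (braidPermFront w π)[k]? = some (.leftCusp k true) := by
  rw [braidPermFront, List.append_assoc,
    List.getElem?_append_left (by rw [List.length_map, List.length_range]; omega)]
  simp [Nat.lt_succ_of_le hk]

theorem strandRightward_lowStrand {m : ℕ} (w : List (Fin m)) (π v : Equiv.Perm (Fin (m + 1)))
    (b : Fin (m + 1)) : strandRightward (braidPermFront w π) (lowStrand v b) = false := by
  rw [strandRightward, lowStrand, braidPermFront_getElem? w π (Nat.sub_le _ _)]
  rfl

theorem strandRightward_upStrand {m : ℕ} (w : List (Fin m)) (π : Equiv.Perm (Fin (m + 1)))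
    (a : Fin (m + 1)) : strandRightward (braidPermFront w π) (upStrand a) = true := by
  rw [strandRightward, upStrand, braidPermFront_getElem? w π (Nat.sub_le _ _)]
  rfl

theorem frontAlong_braidPermFront_iff {m : ℕ} (S : Finset ℕ)
    (P : ℕ → FrontEvent → List (ℕ × Bool) → Prop) (w : List (Fin m))
    (π : Equiv.Perm (Fin (m + 1))) :
    FrontAlong S P 0 [] (braidPermFront w π) ↔
      FrontAlong S P 0 [] ((List.range (m + 1)).map fun k => FrontEvent.leftCusp k true) ∧
      FrontAlong S P (m + 1) (permStrands (1 : Equiv.Perm (Fin (m + 1))))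
        (w.reverse.map fun j => FrontEvent.crossing (Fin.rev j : ℕ)) ∧
      FrontAlong S P (m + 1 + w.length) (permStrands (pathPerm S (m + 1) 1 w.reverse))
        (permTangle π⁻¹) := by
  rw [braidPermFront, List.append_assoc, frontAlong_append, frontAlong_append,
    frontRun_leftCusps_eq_permStrands, List.length_map, List.length_range, zero_add,
    frontRun_crossings, List.length_map, List.length_reverse]

theorem frontRun_braidPermFront {m : ℕ} (w : List (Fin m)) (π : Equiv.Perm (Fin (m + 1))) :
    frontRun ∅ 0 [] (braidPermFront w π) = [] := by
  rw [braidPermFront, frontRun_append, frontRun_append, frontRun_leftCusps_eq_permStrands,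
    List.length_map, List.length_range, zero_add, frontRun_crossings,
    frontRun_permTangle fun k _ => Finset.notMem_empty k]

theorem isOrientedFront_braidPermFront {m : ℕ} (w : List (Fin m))
    (π : Equiv.Perm (Fin (m + 1))) : IsOrientedFront (braidPermFront w π) := by
  refine isOrientedFront_of_frontAlong ?_ (frontRun_braidPermFront w π)
  rw [frontAlong_braidPermFront_iff]
  refine ⟨frontAlong_leftCusps fun k _ l hl => hl, frontAlong_crossings fun k _ _ v j => ?_,
    frontAlong_permTangle (fun k _ => Finset.notMem_empty k) (fun k _ Z W a b _ => ?_)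
      fun k _ Z W a => ⟨?_, ?_⟩⟩
  · change (Fin.rev j : ℕ) + 1 < _
    rw [length_permStrands]
    omega
  · change Z.length + 1 < _
    simp
  · simp
  · rw [(getElem?_append_length _ _ _ _).1, (getElem?_append_length _ _ _ _).2, Option.map_some,
      Option.map_some, strandRightward_lowStrand, strandRightward_upStrand]
    simp

theorem getElem?_permStrands_low {m : ℕ} (v : Equiv.Perm (Fin (m + 1))) {k : ℕ} (hk : k ≤ m) :
    ∃ b, (permStrands v)[k]? = some (lowStrand v b) := by
  rw [permStrands, List.getElem?_append_left (by simp; omega), List.getElem?_map,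
    List.getElem?_eq_getElem (by simp; omega)]
  exact ⟨_, rfl⟩

/-- The positive crossings are those of the braid. -/
theorem isPositiveCrossing_braidPermFront_iff {m : ℕ} (w : List (Fin m))
    (π : Equiv.Perm (Fin (m + 1))) (i : ℕ) :
    IsPositiveCrossing (braidPermFront w π) i ↔ i ∈ Finset.Ico (m + 1) (m + 1 + w.length) := by
  set f := braidPermFront w π with hf
  -- As a condition along the unsmoothed front, the claim can be checked part by part. Braid
  -- crossings join two lower strands, and tangle crossings join a lower strand with an upper one.
  have H : FrontAlong ∅ (fun i e l => (∃ k, e = .crossing k ∧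
      (l[k]?).map (strandRightward f) = (l[k + 1]?).map (strandRightward f)) ↔
      i ∈ Finset.Ico (m + 1) (m + 1 + w.length)) 0 [] f := by
    rw [hf, frontAlong_braidPermFront_iff]
    refine ⟨frontAlong_leftCusps fun k hk l hl => ?_, frontAlong_crossings fun k hk hk' v j => ?_,
      frontAlong_permTangle (fun k _ => Finset.notMem_empty k) (fun k hk Z W a b _ => ?_)
        fun k hk Z W a => ?_⟩
    · simp only [Finset.mem_Ico, reduceCtorEq, false_and, exists_false, false_iff]
      omega
    · rw [List.length_reverse] at hk'
      refine iff_of_true ⟨_, rfl, ?_⟩ (Finset.mem_Ico.mpr ⟨hk, hk'⟩)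
      obtain ⟨b, hb⟩ := getElem?_permStrands_low v (k := Fin.rev j) (by omega)
      obtain ⟨c, hc⟩ := getElem?_permStrands_low v (k := Fin.rev j + 1) (by omega)
      rw [hb, hc, Option.map_some, Option.map_some, strandRightward_lowStrand,
        strandRightward_lowStrand]
    · refine iff_of_false ?_ fun h => ?_
      · rintro ⟨k, hk, h⟩
        cases hk
        rw [(getElem?_append_length _ _ _ _).1, (getElem?_append_length _ _ _ _).2,
          Option.map_some, Option.map_some, strandRightward_lowStrand,
          strandRightward_upStrand] at h
        simp at h
      · have := (Finset.mem_Ico.mp h).2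
        omega
    · simp only [Finset.mem_Ico, reduceCtorEq, false_and, exists_false, false_iff]
      omega
  rw [frontAlong_iff] at H
  constructor
  · rintro ⟨k, hk, h⟩
    exact (H i _ hk).mp ⟨k, rfl, h⟩
  · intro hi
    have hlen : i < f.length := by
      rw [hf, braidPermFront, List.length_append, List.length_append, List.length_map,
        List.length_range, List.length_map, List.length_reverse]
      exact (Finset.mem_Ico.mp hi).2.trans_le (Nat.le_add_right _ _)
    have he := List.getElem?_eq_getElem hlen
    obtain ⟨k, hk, h⟩ := (H i _ he).mpr hi
    exact ⟨k, by rw [he, hk], h⟩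

/-- Positivity confines `S` to the braid part, so `frontAlong_rulingCond_permTangle` applies to the
tangle. -/
theorem isOrientedRuling_braidPermFront_iff {m : ℕ} (w : List (Fin m))
    (π : Equiv.Perm (Fin (m + 1))) (S : Finset ℕ) :
    IsOrientedRuling (braidPermFront w π) S ↔
      S ⊆ Finset.Ico (m + 1) (m + 1 + w.reverse.length) ∧
      PathValid S (m + 1) 1 w.reverse ∧ pathPerm S (m + 1) 1 w.reverse = π⁻¹ := by
  rw [isOrientedRuling_iff, List.length_reverse]
  simp only [isPositiveCrossing_braidPermFront_iff]
  refine and_congr_right fun hS => ?_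
  rw [frontAlong_braidPermFront_iff, and_iff_right (frontAlong_leftCusps fun _ _ _ _ => trivial),
    frontAlong_rulingCond_crossings, frontAlong_rulingCond_permTangle]
  intro k hk hkS
  have := (Finset.mem_Ico.mp (hS k hkS)).2
  omega

theorem countP_isRightCusp_braidPermFront {m : ℕ} (w : List (Fin m))
    (π : Equiv.Perm (Fin (m + 1))) :
    (braidPermFront w π).countP FrontEvent.isRightCusp = m + 1 := by
  have h1 : ((List.range (m + 1)).map fun k => FrontEvent.leftCusp k true).countP
      FrontEvent.isRightCusp = 0 := by
    rw [List.countP_eq_zero]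
    simp [FrontEvent.isRightCusp]
  have h2 : (w.reverse.map fun j => FrontEvent.crossing (Fin.rev j : ℕ)).countP
      FrontEvent.isRightCusp = 0 := by
    rw [List.countP_eq_zero]
    simp [FrontEvent.isRightCusp]
  have h3 (a : Fin (m + 1)) : (tangleBlock π⁻¹ a).countP FrontEvent.isRightCusp = 1 := by
    rw [tangleBlock, List.countP_append, List.countP_eq_zero.mpr (by simp [FrontEvent.isRightCusp])]
    rfl
  rw [braidPermFront, List.countP_append, List.countP_append, h1, h2, permTangle_eq,
    List.countP_flatMap]
  simp [Function.comp_def, h3]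

theorem rulingPolynomial_braidPermFront {m : ℕ} (w : List (Fin m))
    (π : Equiv.Perm (Fin (m + 1))) :
    LaurentPolynomial.T (m : ℤ) * rulingPolynomial (braidPermFront w π) =
      Polynomial.toLaurent (heckeCoord m (toHecke m (positiveBraid w)) π⁻¹) := by
  classical
  rw [heckeCoord_positiveBraid, ← sum_paths π⁻¹ w.reverse (m + 1), ← Finset.sum_filter, map_sum,
    rulingPolynomial, Finset.mul_sum, countP_isRightCusp_braidPermFront]
  have hlen : m + 1 + w.reverse.length ≤ (braidPermFront w π).length := by
    rw [braidPermFront, List.length_append, List.length_append, List.length_map,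
      List.length_range, List.length_map]
    exact Nat.le_add_right _ _
  refine Finset.sum_congr ?_ fun S _ => ?_
  · ext S
    simp only [Finset.mem_filter, Finset.mem_powerset, isOrientedRuling_braidPermFront_iff]
    refine ⟨fun h => h.2, fun h => ⟨fun k hk => ?_, h⟩⟩
    have := (Finset.mem_Ico.mp (h.1 hk)).2
    exact Finset.mem_range.mpr (by omega)
  -- The exponents agree: with `C = m + 1`, one has `m + 1 - C + |S| = |S|`.
  · rw [map_pow, Polynomial.toLaurent_X, LaurentPolynomial.T_pow, ← LaurentPolynomial.T_add]
    congr 1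
    push_cast
    ring

end

theorem mainTheorem4 (m : ℕ) :
    -- Ocneanu's trace is well defined
    (∃! tr : ∀ k : ℕ, HeckeAlgebra k →ₗ[ℤ[X]] ℤ[X][X], IsOcneanuTrace tr) ∧
    -- the negative permutation braids form a basis of the Hecke algebra
    (∃ N : Module.Basis (Equiv.Perm (Fin (m + 1))) ℤ[X] (HeckeAlgebra m),
      ∀ π, N π = toHecke m (negPermBraid π)) ∧
    -- the expansion of a braid in this basis
    (∀ β : BraidGroup m, ∃ c : Equiv.Perm (Fin (m + 1)) → ℤ[X],
      (∀ π, Polynomial.toLaurent (c π) = leftInner β (negPermBraid π)) ∧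
      toHecke m β = ∑ π, c π • toHecke m (negPermBraid π)) ∧
    -- the coefficients for positive braids
    (∀ (w : List (Fin m)) (π : Equiv.Perm (Fin (m + 1))),
      IsOrientedFront (braidPermFront w π) ∧
      leftInner (positiveBraid w) (negPermBraid π) =
        LaurentPolynomial.T (m : ℤ) * rulingPolynomial (braidPermFront w π)) := by
  refine ⟨⟨traceRec, isOcneanuTrace_traceRec, fun tr h => h.unique isOcneanuTrace_traceRec⟩,
    ⟨negPermBasis m, negPermBasis_apply⟩, fun β => ?_, fun w π => ?_⟩
  · exact ⟨fun π => heckeCoord m (toHecke m β) π⁻¹, fun π => (leftInner_negPermBraid β π).symm,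
      sum_heckeCoord_smul _⟩
  · exact ⟨isOrientedFront_braidPermFront w π, by
      rw [leftInner_negPermBraid, rulingPolynomial_braidPermFront]⟩
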